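/- Let $\lambda\ge 0$. Consider the following random process of finite multigraphs in continuous time. At time $0$ the graph is a single vertex without loops. Every vertex, from the moment it appears, carries an exponential clock of rate $1$. When the clock of a vertex $v$ rings, $v$ splits: it is replaced by two new vertices $v_1,v_2$ (each with its own new clock), a $\mathrm{Poisson}(\lambda/2)$-distributed number of edges is added between $v_1$ and $v_2$, and each edge $uv$ is replaced by one of the edges $uv_1$, $uv_2$, chosen uniformly at random. All these random choices are independent, and all vertices are kept, whether or not the graph becomes disconnected. Let $\hat G^\circ_t(\lambda)$ be the multigraph at time $t$. (It is connected if any two of its vertices are joined by a path; a vertex is isolated if it lies on no edge.) Theorem. $\lambda=t$ is a sharp threshold both for the existence of isolated vertices and for connectedness in $\hat G^\circ_t(\lambda)$. That is, let $\varepsilon>0$ and let $\lambda(t)\ge 0$ be any function of $t$. (a) If $\lambda(t)\le(1-\varepsilon)t$ for all sufficiently large $t$, then, as $t\to\infty$, the probability that $\hat G^\circ_t(\lambda(t))$ has an isolated vertex tends to $1$, and the probability that it is connected tends to $0$. (b) If $\lambda(t)\ge(1+\varepsilon)t$ for all sufficiently large $t$, then, as $t\to\infty$, the probability that $\hat G^\circ_t(\lambda(t))$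 has an isolated vertex tends to $0$, and the probability that it is connected tends to $1$. -/

import Mathlib

open MeasureTheory ProbabilityTheory Filter Topology
open scoped NNReal ENNReal

namespace AsyncSplitting

/-- Every vertex that can ever appear is named by its genealogy: `[]` is the initial vertex, and a
vertex `v` that splits is replaced by the two vertices `false :: v` and `true :: v`. -/
abbrev Vertex : Type := List Bool

/-- The edge `(v, k)` is the `k`-th of the new edges that are added between the two offspring of
`v` at the moment when `v` splits. -/
abbrev Edge : Type := Vertex × ℕ

/-- The random input of the process, for all potential vertices and edges at once:
* `ω.1 v` is the time that the clock of `v`, which is started when `v` appears, takes to ring;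
* `ω.2.1 v` is the number of new edges that are added between the offspring of `v`;
* `ω.2.2 (e, w)` tells to which of its two offspring the vertex `w` passes its end of the
  edge `e` when it splits. -/
abbrev Sample : Type := (Vertex → ℝ) × (Vertex → ℕ) × (Edge × Vertex → Bool)

instance isProbabilityMeasure_expMeasure_one : IsProbabilityMeasure (expMeasure 1) :=
  isProbabilityMeasure_expMeasure one_pos

/-- The law of the random input: all coordinates are independent, the clocks are `Exp(1)`, the
numbers of new edges are `Poisson(lam / 2)`, and the choices of offspring are uniform. -/
noncomputable def law (lam : ℝ≥0) : Measure Sample :=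
  (Measure.infinitePi fun _ : Vertex => expMeasure 1).prod
    ((Measure.infinitePi fun _ : Vertex => poissonMeasure (lam / 2)).prod
      (Measure.infinitePi fun _ : Edge × Vertex => (PMF.uniformOfFintype Bool).toMeasure))

/-- The number of new edges between the offspring of `v`. -/
def newEdges (ω : Sample) (v : Vertex) : ℕ := ω.2.1 v

/-- The offspring of `w` that inherits the end at `w` of the edge `e` when `w` splits. -/
def heir (ω : Sample) (e : Edge) (w : Vertex) : Vertex := ω.2.2 (e, w) :: w

/-- The time at which a vertex splits: its time of birth (`0` for the initial vertex, and the
splitting time of the parent for all others) plus the time that its clock takes to ring. -/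
def splitTime (ω : Sample) : Vertex → ℝ
  | [] => ω.1 []
  | b :: v => splitTime ω v + ω.1 (b :: v)

/-- The time at which a vertex appears. -/
def birthTime (ω : Sample) : Vertex → ℝ
  | [] => 0
  | _ :: v => splitTime ω v

/-- The vertex `v` is present at time `t`. -/
def Alive (ω : Sample) (t : ℝ) (v : Vertex) : Prop := birthTime ω v ≤ t ∧ t < splitTime ω v

/-- `Visits ω t e b w`: up to time `t`, the `b`-th end of the edge `e = (v, k)` has been at the
vertex `w`. This end is placed at `b :: v` when `v` splits (provided that `k` is less than the
number of new edges), and whenever the vertex at which it lies splits, it moves on to the chosen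
offspring. -/
inductive Visits (ω : Sample) (t : ℝ) (e : Edge) (b : Bool) : Vertex → Prop
  | start : splitTime ω e.1 ≤ t → e.2 < newEdges ω e.1 → Visits ω t e b (b :: e.1)
  | move {w : Vertex} : Visits ω t e b w → splitTime ω w ≤ t → Visits ω t e b (heir ω e w)

/-- At time `t`, the `b`-th end of the edge `e` is at the vertex `x`. -/
def EndAt (ω : Sample) (t : ℝ) (e : Edge) (b : Bool) (x : Vertex) : Prop :=
  Visits ω t e b x ∧ Alive ω t x

/-- Of two distinct vertices visited by the same end of an edge, one has split. -/
theorem Visits.total {ω : Sample} {t : ℝ} {e : Edge} {b : Bool} {x y : Vertex}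
    (hx : Visits ω t e b x) (hy : Visits ω t e b y) :
    x = y ∨ splitTime ω x ≤ t ∨ splitTime ω y ≤ t := by
  have key : ∀ {x : Vertex}, Visits ω t e b x → ∀ {y : Vertex}, Visits ω t e b y →
      (x.length = y.length → x = y) ∧ (x.length < y.length → splitTime ω x ≤ t) := by
    have low : ∀ {y : Vertex}, Visits ω t e b y → e.1.length + 1 ≤ y.length := by
      intro y hy
      induction hy with
      | start _ _ => simp
      | move _ _ ih => simp only [heir, List.length_cons]; omega
    intro x hx y hy
    induction hy generalizing x with
    | start _ _ =>
      have h1 := low hx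
      refine ⟨fun h => ?_, fun h => ?_⟩
      · cases hx with
        | start _ _ => rfl
        | move h' _ =>
          have h2 := low h'
          simp only [heir, List.length_cons] at h
          omega
      · simp only [List.length_cons] at h
        omega
    | @move w hw hs ih =>
      refine ⟨fun h => ?_, fun h => ?_⟩
      · cases hx with
        | start _ _ =>
          have h2 := low hw
          simp only [heir, List.length_cons] at h
          omega
        | @move z h' _ =>
          simp only [heir, List.length_cons, add_left_inj] at h
          rw [(ih h').1 h]
      · simp only [heir, List.length_cons] at h
        rcases Nat.lt_or_ge x.length w.length with h3 | h3
        · exact (ih hx).2 h3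
        · rw [(ih hx).1 (by omega)]
          exact hs
  rcases lt_trichotomy x.length y.length with h | h | h
  · exact Or.inr (Or.inl ((key hx hy).2 h))
  · exact Or.inl ((key hx hy).1 h)
  · exact Or.inr (Or.inr ((key hy hx).2 h))

/-- At any time, each end of an edge is at no more than one vertex. -/
theorem EndAt.unique {ω : Sample} {t : ℝ} {e : Edge} {b : Bool} {x y : Vertex}
    (hx : EndAt ω t e b x) (hy : EndAt ω t e b y) : x = y := by
  rcases hx.1.total hy.1 with h | h | h
  · exact h
  · exact absurd h (not_le.2 hx.2.2)
  · exact absurd h (not_le.2 hy.2.2)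

/-- The multigraph at time `t` of the asynchronous splitting process that starts from a single
vertex without loops, all vertices being kept: its vertices are those present at time `t`, and an
edge joins the two vertices at which its ends are at time `t`. -/
def graphAt (ω : Sample) (t : ℝ) : Graph Vertex Edge where
  vertexSet := {v | Alive ω t v}
  IsLink e x y := ∃ b : Bool, EndAt ω t e b x ∧ EndAt ω t e (!b) y
  isLink_symm := by
    intro e _
    refine ⟨fun x y => ?_⟩
    rintro ⟨b, hx, hy⟩
    exact ⟨!b, hy, by simpa using hx⟩
  eq_or_eq_of_isLink_of_isLink := by
    rintro e x y v w ⟨b, hx, hy⟩ ⟨c, hv, hw⟩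
    by_cases h : c = b
    · subst h
      exact Or.inl (hx.unique hv)
    · have h' : (!c) = b := by cases b <;> cases c <;> simp_all
      rw [h'] at hw
      exact Or.inr (hx.unique hw)
  left_mem_of_isLink := by
    rintro e x y ⟨b, hx, _⟩
    exact hx.2

/-- The multigraph has an isolated vertex, i.e. a vertex that is incident with no edge. -/
def HasIsolatedVertex {α β : Type*} (G : Graph α β) : Prop :=
  ∃ x ∈ G.vertexSet, ∀ e, ¬ G.Inc e x

/-- The multigraph is connected: it has a vertex, and any two vertices are joined by a walk. -/
def IsConnected {α β : Type*} (G : Graph α β) : Prop :=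
  G.vertexSet.Nonempty ∧
    ∀ x ∈ G.vertexSet, ∀ y ∈ G.vertexSet, Relation.ReflTransGen G.Adj x y

/-- The probability that the graph at time `t`, with parameter `lam`, has an isolated vertex. -/
noncomputable def probIsolated (lam : ℝ≥0) (t : ℝ) : ℝ≥0∞ :=
  law lam {ω | HasIsolatedVertex (graphAt ω t)}

/-- The probability that the graph at time `t`, with parameter `lam`, is connected. -/
noncomputable def probConnected (lam : ℝ≥0) (t : ℝ) : ℝ≥0∞ :=
  law lam {ω | IsConnected (graphAt ω t)}

end AsyncSplitting

/-! Every potential vertex has a name fixed in advance, and the clocks are independent of the marks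
(numbers of edges and choices of heirs). Mark events at given names are therefore estimated first
and then weighed with the clocks. The basic tool is Poisson thinning, `markLaw_noEdge`: the event
that no edge born at the vertices `u ∈ U` takes a route in `Q u` has probability exp(-(λ/2) ∑ P(Q
u)).

Isolated vertices. An edge born j generations above the parent of x is led to x with probability
2^(-j), so by thinning x receives no edge with probability at least e^(-λ). The population is a Yule
process, of size about e^t, which suggests at least about e^(t-λ) isolated vertices. For λ ≤ (1-ε)t
the second moment method applies: an edge can reach two incomparable vertices only if it is born at
their last common ancestor, so the two events are almost uncorrelated unless both vertices are close
to that ancestor, and such pairs are few.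

Connectedness. The graph is followed generation by generation: it stays connected if the two
offspring of every split vertex v are joined in the graph in which splitting stops one generation
below v. They are joined if v adds an edge, or if some ancestor of v has sent edges to both
offspring from a subtree hanging off the line of ancestors, all of whose relevant splits add an
edge. The absence of an edge at v costs λ/2 in the exponent, and a failure at the i-th ancestor
costs at least (λ/2) 2^(-(i+1)). These failures happen at different vertices, so the costs for the
first K ancestors add up to λ(1 - 2^(-(K+1))), see `markLaw_badMarks_le`. For large fixed K and λ ≥
(1+ε)t this beats the expected number of splits, which is at most a constant times e^((1+δ)t).

A connected graph with at least two vertices has no isolated vertex, so these two estimates also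
give the other two limits. -/

namespace AsyncSplitting

/-! ### Laws of clocks and marks -/

/-- The law of the clocks. -/
noncomputable def clockLaw : Measure (Vertex → ℝ) :=
  Measure.infinitePi fun _ : Vertex => expMeasure 1

/-- The law of the choices made along the route of one edge. -/
noncomputable def choiceLaw : Measure (Vertex → Bool) :=
  Measure.infinitePi fun _ : Vertex => (PMF.uniformOfFintype Bool).toMeasure

/-- The numbers of new edges together with all choices of offspring. -/
abbrev Marks : Type := (Vertex → ℕ) × (Edge × Vertex → Bool)

/-- The law of the marks. -/
noncomputable def markLaw (lam : ℝ≥0) : Measure Marks :=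
  (Measure.infinitePi fun _ : Vertex => poissonMeasure (lam / 2)).prod
    (Measure.infinitePi fun _ : Edge × Vertex => (PMF.uniformOfFintype Bool).toMeasure)

instance : IsProbabilityMeasure clockLaw := by unfold clockLaw; infer_instance
instance : IsProbabilityMeasure choiceLaw := by unfold choiceLaw; infer_instance
instance (lam : ℝ≥0) : IsProbabilityMeasure (markLaw lam) := by unfold markLaw; infer_instance

theorem law_eq (lam : ℝ≥0) : law lam = clockLaw.prod (markLaw lam) := rfl

instance (lam : ℝ≥0) : IsProbabilityMeasure (law lam) := by rw [law_eq]; infer_instance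

/-! ### Poisson thinning -/

theorem lintegral_infinitePi_prod {ι X : Type*} [MeasurableSpace X] (μ : ι → Measure X)
    [∀ i, IsProbabilityMeasure (μ i)] (s : Finset ι) (f : ι → X → ℝ≥0∞)
    (hf : ∀ i, Measurable (f i)) :
    ∫⁻ ω, ∏ i ∈ s, f i (ω i) ∂(Measure.infinitePi μ) = ∏ i ∈ s, ∫⁻ x, f i x ∂(μ i) := by
  refine (lintegral_prod_eq_prod_lintegral_of_indepFun s (fun i (ω : ι → X) => f i (ω i))
    (iIndepFun_infinitePi hf) (fun i => (hf i).comp (measurable_pi_apply i))).trans ?_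
  refine Finset.prod_congr rfl fun i _ => ?_
  rw [← Measure.infinitePi_map_eval μ i, lintegral_map (hf i) (measurable_pi_apply i)]

theorem lintegral_pow_poissonMeasure (r : ℝ≥0) {c : ℝ} (hc : 0 ≤ c) :
    ∫⁻ n, ENNReal.ofReal c ^ n ∂(poissonMeasure r) = ENNReal.ofReal (Real.exp (-(r * (1 - c)))) := by
  rw [poissonMeasure, lintegral_sum_measure]
  simp only [lintegral_smul_measure, lintegral_dirac, smul_eq_mul]
  have h : ∀ n : ℕ, ENNReal.ofReal (Real.exp (-r) * r ^ n / n.factorial) * ENNReal.ofReal c ^ n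
      = ENNReal.ofReal (Real.exp (-r) * ((r * c) ^ n / n.factorial)) := by
    intro n
    rw [← ENNReal.ofReal_pow hc, ← ENNReal.ofReal_mul (by positivity)]
    congr 1
    rw [mul_pow]; ring
  simp only [h]
  have hs : HasSum (fun n : ℕ => Real.exp (-r) * (((r : ℝ) * c) ^ n / n.factorial))
      (Real.exp (-r) * Real.exp (r * c)) := by
    have := NormedSpace.expSeries_div_hasSum_exp (𝔸 := ℝ) ((r : ℝ) * c)
    rw [← Real.exp_eq_exp_ℝ] at this
    exact this.mul_left _
  rw [← ENNReal.ofReal_tsum_of_nonneg (fun n => by positivity) hs.summable, hs.tsum_eq,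
    ← Real.exp_add]
  congr 2; ring

/-- No edge that is added when `u` splits makes choices in `Q`. -/
def noEdge (u : Vertex) (Q : Set (Vertex → Bool)) : Set Marks :=
  {η | ∀ k < η.1 u, (fun w => η.2 ((u, k), w)) ∉ Q}

theorem measurableSet_noEdge (u : Vertex) {Q : Set (Vertex → Bool)} (hQ : MeasurableSet Q) :
    MeasurableSet (noEdge u Q) := by
  have h : noEdge u Q = ⋂ k : ℕ, ({η : Marks | k < η.1 u}ᶜ ∪
      (fun (η : Marks) w => η.2 ((u, k), w)) ⁻¹' Qᶜ) := by
    ext η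
    simp only [noEdge, Set.mem_ofPred_eq, Set.mem_iInter, Set.mem_union, Set.mem_compl_iff,
      Set.mem_preimage, imp_iff_not_or]
  rw [h]
  refine MeasurableSet.iInter fun k => (MeasurableSet.compl ?_).union ?_
  · have : Measurable fun η : Marks => η.1 u := by fun_prop
    exact this (measurableSet_Ioi : MeasurableSet (Set.Ioi k))
  · have : Measurable fun (η : Marks) (w : Vertex) => η.2 ((u, k), w) := by fun_prop
    exact this hQ.compl

/-- Currying turns the family of all choices into independent copies of `choiceLaw`, one for each
edge; with the numbers `N u` fixed, the event is a finite cylinder over the edges. -/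
theorem infinitePi_uniform_noEdge (U : Finset Vertex) (Q : Vertex → Set (Vertex → Bool))
    (hQ : ∀ u, MeasurableSet (Q u)) (N : Vertex → ℕ) :
    (Measure.infinitePi fun _ : Edge × Vertex => (PMF.uniformOfFintype Bool).toMeasure)
      {χ | ∀ u ∈ U, ∀ k < N u, (fun w => χ ((u, k), w)) ∉ Q u} =
      ∏ u ∈ U, (1 - choiceLaw (Q u)) ^ N u := by
  have hc := Measure.infinitePi_map_curry
    (fun (_ : Edge) (_ : Vertex) => (PMF.uniformOfFintype Bool).toMeasure)
  set S : Finset Edge :=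
    (U.sigma fun u => Finset.range (N u)).map (Equiv.sigmaEquivProd _ _).toEmbedding with hS
  have hmem : ∀ e : Edge, e ∈ S ↔ e.1 ∈ U ∧ e.2 < N e.1 := by
    intro e
    simp only [hS, Finset.mem_map_equiv, Finset.mem_sigma, Finset.mem_range]
    rfl
  have hset : {χ : Edge × Vertex → Bool | ∀ u ∈ U, ∀ k < N u, (fun w => χ ((u, k), w)) ∉ Q u}
      = (MeasurableEquiv.curry Edge Vertex Bool) ⁻¹'
        (Set.pi (S : Set Edge) fun e => (Q e.1)ᶜ) := by
    ext χ
    simp only [Set.mem_ofPred_eq, Set.mem_preimage, Set.mem_pi, Finset.mem_coe, hmem,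
      Set.mem_compl_iff]
    constructor
    · rintro h ⟨u, k⟩ ⟨h1, h2⟩
      exact h u h1 k h2
    · intro h u hu k hk
      exact h (u, k) ⟨hu, hk⟩
  rw [hset, ← Measure.map_apply (MeasurableEquiv.measurable _)
    (MeasurableSet.pi S.countable_toSet fun e _ => (hQ e.1).compl), hc,
    Measure.infinitePi_pi _ (fun e _ => (hQ e.1).compl), hS, Finset.prod_map, Finset.prod_sigma]
  refine Finset.prod_congr rfl fun u _ => ?_
  have : (Measure.infinitePi fun _ : Vertex => (PMF.uniformOfFintype Bool).toMeasure) (Q u)ᶜ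
      = 1 - choiceLaw (Q u) := prob_compl_eq_one_sub (hQ u)
  simp [this]

/-- Poisson thinning: the probability that no new edge at finitely many vertices makes choices in
prescribed sets. -/
theorem markLaw_noEdge (lam : ℝ≥0) (U : Finset Vertex) (Q : Vertex → Set (Vertex → Bool))
    (hQ : ∀ u, MeasurableSet (Q u)) :
    markLaw lam {η | ∀ u ∈ U, η ∈ noEdge u (Q u)} =
      ENNReal.ofReal (Real.exp (-(lam / 2 * ∑ u ∈ U, choiceLaw.real (Q u)))) := by
  have hm : MeasurableSet {η : Marks | ∀ u ∈ U, η ∈ noEdge u (Q u)} := by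
    have : {η : Marks | ∀ u ∈ U, η ∈ noEdge u (Q u)} = ⋂ u ∈ U, noEdge u (Q u) := by
      ext; simp
    rw [this]
    exact Finset.measurableSet_biInter _ fun u _ => measurableSet_noEdge u (hQ u)
  have hq : ∀ u, 1 - choiceLaw (Q u) = ENNReal.ofReal (1 - choiceLaw.real (Q u)) := by
    intro u
    rw [ENNReal.ofReal_sub _ measureReal_nonneg, ENNReal.ofReal_one, ofReal_measureReal]
  rw [markLaw, Measure.prod_apply hm]
  have h : ∀ N : Vertex → ℕ,
      (Measure.infinitePi fun _ : Edge × Vertex => (PMF.uniformOfFintype Bool).toMeasure)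
      (Prod.mk N ⁻¹' {η : Marks | ∀ u ∈ U, η ∈ noEdge u (Q u)}) =
      ∏ u ∈ U, ENNReal.ofReal (1 - choiceLaw.real (Q u)) ^ N u := by
    intro N
    simp only [← hq]
    exact infinitePi_uniform_noEdge U Q hQ N
  simp only [h]
  rw [lintegral_infinitePi_prod (fun _ : Vertex => poissonMeasure (lam / 2)) U
    (fun u n => ENNReal.ofReal (1 - choiceLaw.real (Q u)) ^ n) (fun u => measurable_of_countable _)]
  rw [Finset.mul_sum, ← Finset.sum_neg_distrib, Real.exp_sum,
    ENNReal.ofReal_prod_of_nonneg (fun _ _ => (Real.exp_pos _).le)]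
  refine Finset.prod_congr rfl fun u _ => ?_
  rw [lintegral_pow_poissonMeasure _ (sub_nonneg.2 measureReal_le_one)]
  simp

/-! ### Routes of edges -/

/-- An end of an edge with choices `χ` moves from `a` to `l ++ a`. -/
def Follow (χ : Vertex → Bool) (a : Vertex) : Vertex → Prop
  | [] => True
  | c :: l => Follow χ a l ∧ χ (l ++ a) = c

/-- Following a route prescribes one choice at each vertex passed. These vertices are distinct
because their lengths increase, which is what the length bound records for the induction. -/
theorem setOf_follow_eq_pi (a : Vertex) : ∀ l : Vertex, ∃ (s : Finset Vertex) (f : Vertex → Bool),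
    s.card = l.length ∧ (∀ w ∈ s, w.length < l.length + a.length) ∧
    {χ | Follow χ a l} = Set.pi (s : Set Vertex) fun w => {f w}
  | [] => ⟨∅, fun _ => true, by simp [Follow]⟩
  | c :: l => by
    obtain ⟨s, f, h1, h2, h3⟩ := setOf_follow_eq_pi a l
    have hn : l ++ a ∉ s := fun h => by simpa using h2 _ h
    refine ⟨insert (l ++ a) s, Function.update f (l ++ a) c, ?_, ?_, ?_⟩
    · rw [Finset.card_insert_of_notMem hn, h1, List.length_cons]
    · intro w hw
      rcases Finset.mem_insert.1 hw with rfl | hw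
      · simp
      · have := h2 w hw
        simp; omega
    · ext χ
      have := Set.ext_iff.1 h3 χ
      simp only [Set.mem_ofPred_eq, Set.mem_pi, Finset.mem_coe, Set.mem_singleton_iff] at this
      simp only [Set.mem_ofPred_eq, Follow, this, Set.mem_pi, Finset.mem_coe, Finset.mem_insert,
        Set.mem_singleton_iff, forall_eq_or_imp, Function.update_self]
      rw [and_comm]
      refine and_congr_right fun _ => forall₂_congr fun w hw => ?_
      rw [Function.update_of_ne]
      rintro rfl
      exact hn hw

theorem measurableSet_follow (a l : Vertex) : MeasurableSet {χ | Follow χ a l} := by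
  obtain ⟨s, f, _, _, h⟩ := setOf_follow_eq_pi a l
  rw [h]
  exact MeasurableSet.pi s.countable_toSet fun _ _ => measurableSet_singleton _

theorem choiceLaw_follow (a l : Vertex) :
    choiceLaw.real {χ | Follow χ a l} = (1 / 2 : ℝ) ^ l.length := by
  obtain ⟨s, f, h1, _, h⟩ := setOf_follow_eq_pi a l
  rw [h, measureReal_def, choiceLaw, Measure.infinitePi_pi _ (fun _ _ => measurableSet_singleton _)]
  simp [h1]

/-! ### Splitting times and their exponential moments -/

/-- The splitting times, as functions of the clocks alone. -/
def clockSplit (c : Vertex → ℝ) : Vertex → ℝ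
  | [] => c []
  | b :: v => clockSplit c v + c (b :: v)

/-- The times of birth, as functions of the clocks alone. -/
def clockBirth (c : Vertex → ℝ) : Vertex → ℝ
  | [] => 0
  | _ :: v => clockSplit c v

/-- The vertex `v` is present at time `t`, in terms of the clocks alone. -/
def ClockAlive (c : Vertex → ℝ) (t : ℝ) (v : Vertex) : Prop :=
  clockBirth c v ≤ t ∧ t < clockSplit c v

theorem splitTime_eq (ω : Sample) : ∀ v, splitTime ω v = clockSplit ω.1 v
  | [] => rfl
  | b :: v => by simp only [splitTime, clockSplit, splitTime_eq ω v]

theorem birthTime_eq (ω : Sample) : ∀ v, birthTime ω v = clockBirth ω.1 v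
  | [] => rfl
  | _ :: v => splitTime_eq ω v

theorem alive_iff (ω : Sample) (t : ℝ) (v : Vertex) : Alive ω t v ↔ ClockAlive ω.1 t v := by
  rw [Alive, ClockAlive, splitTime_eq, birthTime_eq]

@[fun_prop]
theorem measurable_clockSplit : ∀ v, Measurable fun c => clockSplit c v
  | [] => measurable_pi_apply _
  | _ :: v => (measurable_clockSplit v).add (measurable_pi_apply _)

@[fun_prop]
theorem measurable_clockBirth : ∀ v, Measurable fun c => clockBirth c v
  | [] => measurable_const
  | _ :: v => measurable_clockSplit v

theorem measurableSet_clockAlive (t : ℝ) (v : Vertex) : MeasurableSet {c | ClockAlive c t v} :=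
  (measurableSet_le (measurable_clockBirth v) measurable_const).inter
    (measurableSet_lt measurable_const (measurable_clockSplit v))

theorem lintegral_expMeasure_one {f : ℝ → ℝ≥0∞} (hf : Measurable f) :
    ∫⁻ x, f x ∂(expMeasure 1) = ∫⁻ x in Set.Ici 0, ENNReal.ofReal (Real.exp (-x)) * f x := by
  have h : expMeasure 1 = volume.withDensity (exponentialPDF 1) := rfl
  have hm : Measurable (exponentialPDF 1) :=
    (measurable_exponentialPDFReal 1).ennreal_ofReal
  rw [h, lintegral_withDensity_eq_lintegral_mul _ hm hf, ← lintegral_indicator measurableSet_Ici]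
  refine lintegral_congr fun x => ?_
  simp only [Pi.mul_apply, exponentialPDF_eq, Set.indicator, Set.mem_Ici, one_mul]
  split_ifs <;> simp

theorem lintegral_exp_expMeasure_one {θ : ℝ} (hθ : 0 ≤ θ) :
    ∫⁻ x, ENNReal.ofReal (Real.exp (-(θ * x))) ∂(expMeasure 1) = ENNReal.ofReal (1 / (1 + θ)) := by
  have hp : 0 < 1 + θ := by linarith
  rw [lintegral_expMeasure_one (by fun_prop)]
  have h1 := lintegral_exponentialPDF_eq_one hp
  have h2 : ∫⁻ x, exponentialPDF (1 + θ) x = ∫⁻ x in Set.Ici 0,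
      ENNReal.ofReal (1 + θ) * (ENNReal.ofReal (Real.exp (-x)) *
        ENNReal.ofReal (Real.exp (-(θ * x)))) := by
    rw [← lintegral_indicator measurableSet_Ici]
    refine lintegral_congr fun x => ?_
    simp only [exponentialPDF_eq, Set.indicator, Set.mem_Ici]
    split_ifs
    · rw [← ENNReal.ofReal_mul (Real.exp_pos _).le, ← ENNReal.ofReal_mul hp.le, ← Real.exp_add]
      congr 3; ring
    · simp
  rw [h2, lintegral_const_mul _ (by fun_prop)] at h1
  rw [one_div, ENNReal.ofReal_inv_of_pos hp]
  exact ENNReal.eq_inv_of_mul_eq_one_left (by rw [mul_comm]; exact h1)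

theorem expMeasure_one_Ioi {t : ℝ} (ht : 0 ≤ t) :
    expMeasure 1 (Set.Ioi t) = ENNReal.ofReal (Real.exp (-t)) := by
  have h : expMeasure 1 (Set.Iic t) = ENNReal.ofReal (1 - Real.exp (-t)) := by
    have h0 : expMeasure 1 = volume.withDensity (exponentialPDF 1) := rfl
    rw [h0, withDensity_apply _ measurableSet_Iic, lintegral_exponentialPDF_eq_antiDeriv one_pos,
      if_pos ht, one_mul]
  have hle : Real.exp (-t) ≤ 1 := Real.exp_le_one_iff.2 (by linarith)
  rw [← Set.compl_Iic, prob_compl_eq_one_sub measurableSet_Iic, h, ← ENNReal.ofReal_one,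
    ← ENNReal.ofReal_sub _ (by linarith)]
  congr 1; ring

theorem clockLaw_lt_clock {t : ℝ} (ht : 0 ≤ t) (v : Vertex) :
    clockLaw {c | t < c v} = ENNReal.ofReal (Real.exp (-t)) := by
  rw [← expMeasure_one_Ioi ht, ← Measure.infinitePi_map_eval (fun _ : Vertex => expMeasure 1) v,
    Measure.map_apply (measurable_pi_apply v) measurableSet_Ioi]
  rfl

theorem ae_clock_pos : ∀ᵐ c ∂clockLaw, ∀ v, 0 < c v := by
  rw [ae_all_iff]
  intro v
  have h := clockLaw_lt_clock le_rfl v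
  rw [neg_zero, Real.exp_zero, ENNReal.ofReal_one] at h
  exact (prob_compl_eq_zero_iff (measurableSet_lt measurable_const (measurable_pi_apply v))).2 h

/-- The splitting time is the sum of the clocks of the vertex and its ancestors, i.e. over the
suffixes of its name; the product form makes independence applicable. -/
theorem exp_clockSplit (θ : ℝ) (c : Vertex → ℝ) : ∀ v : Vertex,
    ENNReal.ofReal (Real.exp (-(θ * clockSplit c v))) =
      ∏ w ∈ v.tails.toFinset, ENNReal.ofReal (Real.exp (-(θ * c w)))
  | [] => by simp [clockSplit]
  | b :: v => by
    have h : (b :: v) ∉ v.tails.toFinset := by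
      simp only [List.mem_toFinset, List.mem_tails]
      intro h
      simpa using h.length_le
    rw [List.tails_cons, List.toFinset_cons, Finset.prod_insert h, ← exp_clockSplit θ c v,
      ← ENNReal.ofReal_mul (Real.exp_pos _).le, ← Real.exp_add, clockSplit]
    congr 2; ring

theorem card_tails_toFinset : ∀ v : Vertex, v.tails.toFinset.card = v.length + 1
  | [] => rfl
  | b :: v => by
    have h : (b :: v) ∉ v.tails.toFinset := by
      simp only [List.mem_toFinset, List.mem_tails]
      intro h
      simpa using h.length_le
    rw [List.tails_cons, List.toFinset_cons, Finset.card_insert_of_notMem h, card_tails_toFinset v,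
      List.length_cons]

/-- The Chernoff bound for the splitting time of a vertex. -/
theorem clockLaw_clockSplit_le (v : Vertex) (t : ℝ) {θ : ℝ} (hθ : 0 ≤ θ) :
    clockLaw {c | clockSplit c v ≤ t} ≤
      ENNReal.ofReal (Real.exp (θ * t) * (1 / (1 + θ)) ^ (v.length + 1)) := by
  have hI : ∫⁻ c, ENNReal.ofReal (Real.exp (-(θ * clockSplit c v))) ∂clockLaw =
      ENNReal.ofReal ((1 / (1 + θ)) ^ (v.length + 1)) := by
    simp only [exp_clockSplit]
    rw [clockLaw, lintegral_infinitePi_prod _ _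
      (fun _ x => ENNReal.ofReal (Real.exp (-(θ * x)))) (by fun_prop)]
    rw [Finset.prod_const, card_tails_toFinset, lintegral_exp_expMeasure_one hθ,
      ENNReal.ofReal_pow (by positivity)]
  have hM := mul_meas_ge_le_lintegral (μ := clockLaw)
    (f := fun c => ENNReal.ofReal (Real.exp (-(θ * clockSplit c v)))) (by fun_prop)
    (ENNReal.ofReal (Real.exp (-(θ * t))))
  rw [hI] at hM
  rw [ENNReal.ofReal_mul (Real.exp_pos _).le]
  have he : ENNReal.ofReal (Real.exp (θ * t)) * ENNReal.ofReal (Real.exp (-(θ * t))) = 1 := by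
    rw [← ENNReal.ofReal_mul (Real.exp_pos _).le, ← Real.exp_add]
    simp
  calc clockLaw {c | clockSplit c v ≤ t}
      = ENNReal.ofReal (Real.exp (θ * t)) * (ENNReal.ofReal (Real.exp (-(θ * t))) *
        clockLaw {c | clockSplit c v ≤ t}) := by rw [← mul_assoc, he, one_mul]
    _ ≤ _ := by
      gcongr
      refine le_trans ?_ hM
      gcongr with c
      intro hc
      refine ENNReal.ofReal_le_ofReal (Real.exp_le_exp.2 ?_)
      have : clockSplit c v ≤ t := hc
      nlinarith

/-! ### Branching property and lower tail of the population size -/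

/-- The clocks of the descendants of an offspring of the initial vertex. -/
def subClocks (c : Vertex → ℝ) (b : Bool) : Vertex → ℝ := fun v => c (v ++ [b])

/-- The clocks that consist of the clock of the initial vertex and those of the two subtrees. -/
def joinClocks (p : ℝ × (Vertex → ℝ) × (Vertex → ℝ)) (v : Vertex) : ℝ :=
  match v.getLast? with
  | none => p.1
  | some false => p.2.1 v.dropLast
  | some true => p.2.2 v.dropLast

theorem measurable_joinClocks : Measurable joinClocks := by
  refine measurable_pi_iff.2 fun v => ?_
  unfold joinClocks
  rcases v.getLast? with _ | _ | _
  · exact measurable_fst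
  · exact (measurable_pi_apply _).comp (measurable_fst.comp measurable_snd)
  · exact (measurable_pi_apply _).comp (measurable_snd.comp measurable_snd)

/-- Names list the most recent birth first, so the subtree of the offspring `b` of the root consists
of the lists that end in `b`. -/
theorem prod_vertex_eq (s : Finset Vertex) (F : Vertex → ℝ≥0∞) :
    ∏ v ∈ s, F v = (if [] ∈ s then F [] else 1) *
      ((∏ l ∈ s.preimage (· ++ [false]) (List.append_left_injective _).injOn, F (l ++ [false])) *
      ∏ l ∈ s.preimage (· ++ [true]) (List.append_left_injective _).injOn, F (l ++ [true])) := by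
  have key : ∀ b : Bool,
      ∏ l ∈ s.preimage (· ++ [b]) (List.append_left_injective _).injOn, F (l ++ [b]) =
      ∏ v ∈ s with v.getLast? = some b, F v := by
    intro b
    refine Finset.prod_bij (fun l _ => l ++ [b]) ?_ ?_ ?_ ?_
    · intro l hl
      simpa using hl
    · intro l _ l' _ h
      simpa using h
    · intro v hv
      obtain ⟨hv, hb⟩ := Finset.mem_filter.1 hv
      obtain ⟨l, rfl⟩ := List.getLast?_eq_some_iff.1 hb
      exact ⟨l, by simpa using hv, rfl⟩
    · intro l _
      rfl
  have key0 : (if [] ∈ s then F [] else 1) = ∏ v ∈ s with v.getLast? = none, F v := by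
    have : (s.filter fun v : Vertex => v.getLast? = none) = if [] ∈ s then {[]} else ∅ := by
      ext v
      simp only [Finset.mem_filter, List.getLast?_eq_none_iff]
      split_ifs with h
      · simp only [Finset.mem_singleton]
        exact ⟨fun h => h.2, fun h' => ⟨h'.symm ▸ h, h'⟩⟩
      · simp only [Finset.notMem_empty, iff_false]
        rintro ⟨h', rfl⟩
        exact h h'
    rw [this]
    split_ifs <;> simp
  rw [key, key, key0, ← Finset.prod_fiberwise s (fun v => v.getLast?), Fintype.prod_option,
    Fintype.prod_bool, mul_comm (∏ v ∈ s with v.getLast? = some true, F v)]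

/-- The branching property: the clock of the initial vertex and the clocks of the two subtrees are
independent, and the latter have the law of the whole. -/
theorem map_joinClocks :
    ((expMeasure 1).prod (clockLaw.prod clockLaw)).map joinClocks = clockLaw := by
  refine Measure.eq_infinitePi _ fun s T hT => ?_
  rw [Measure.map_apply measurable_joinClocks (MeasurableSet.pi s.countable_toSet fun v _ => hT v)]
  set T' : Bool → Set (Vertex → ℝ) := fun b =>
    Set.pi (s.preimage (· ++ [b]) (List.append_left_injective _).injOn : Finset Vertex)
      fun l => T (l ++ [b]) with hT'
  have hset : joinClocks ⁻¹' (Set.pi s T) =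
      {a | [] ∈ s → a ∈ T []} ×ˢ (T' false ×ˢ T' true) := by
    ext ⟨a, f, g⟩
    simp only [Set.mem_preimage, Set.mem_pi, Set.mem_prod, Set.mem_ofPred_eq, hT', Finset.coe_preimage,
      Finset.mem_coe]
    constructor
    · intro h
      refine ⟨fun h0 => h [] h0, fun l hl => ?_, fun l hl => ?_⟩
      · simpa [joinClocks] using h _ hl
      · simpa [joinClocks] using h _ hl
    · rintro ⟨h1, h2, h3⟩ v hv
      rcases List.eq_nil_or_concat v with rfl | ⟨l, b, rfl⟩
      · exact h1 hv
      · rw [List.concat_eq_append] at hv ⊢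
        cases b
        · simpa [joinClocks] using h2 l hv
        · simpa [joinClocks] using h3 l hv
  have hb : ∀ b, clockLaw (T' b) = ∏ l ∈ s.preimage (· ++ [b])
      (List.append_left_injective _).injOn, expMeasure 1 (T (l ++ [b])) := fun b =>
    Measure.infinitePi_pi _ fun l _ => hT _
  rw [hset, Measure.prod_prod, Measure.prod_prod, hb, hb, prod_vertex_eq s]
  congr 1
  by_cases h : [] ∈ s <;> simp [h]

theorem lintegral_clockLaw {F : (Vertex → ℝ) → ℝ≥0∞} (hF : Measurable F) :
    ∫⁻ c, F c ∂clockLaw =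
      ∫⁻ a, ∫⁻ f, ∫⁻ g, F (joinClocks (a, f, g)) ∂clockLaw ∂clockLaw ∂(expMeasure 1) := by
  have hm : Measurable fun p => F (joinClocks p) := hF.comp measurable_joinClocks
  conv_lhs => rw [← map_joinClocks]
  rw [lintegral_map hF measurable_joinClocks, lintegral_prod _ hm.aemeasurable]
  refine lintegral_congr fun a => ?_
  exact lintegral_prod _ (hm.comp measurable_prodMk_left).aemeasurable

theorem clockSplit_append (c : Vertex → ℝ) (b : Bool) : ∀ v,
    clockSplit c (v ++ [b]) = c [] + clockSplit (subClocks c b) v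
  | [] => rfl
  | a :: v => by
    rw [List.cons_append, clockSplit, clockSplit_append c b v, clockSplit, ← add_assoc]
    rfl

theorem clockBirth_append (c : Vertex → ℝ) (b : Bool) (v : Vertex) :
    clockBirth c (v ++ [b]) = c [] + clockBirth (subClocks c b) v := by
  cases v with
  | nil => simp [clockBirth, clockSplit]
  | cons a v => exact clockSplit_append c b v

theorem clockAlive_append (c : Vertex → ℝ) (b : Bool) (t : ℝ) (v : Vertex) :
    ClockAlive c t (v ++ [b]) ↔ ClockAlive (subClocks c b) (t - c []) v := by
  rw [ClockAlive, ClockAlive, clockSplit_append, clockBirth_append, sub_lt_iff_lt_add',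
    le_sub_iff_add_le']

/-- The function `z ^ k`, where `k` is the number of vertices of length less than `n` that are
present at time `t`. -/
noncomputable def truncPow (z : ℝ≥0∞) : ℕ → ℝ → (Vertex → ℝ) → ℝ≥0∞
  | 0, _, _ => 1
  | n + 1, t, c => if t < c [] then z else
      truncPow z n (t - c []) (subClocks c false) * truncPow z n (t - c []) (subClocks c true)

theorem measurable_truncPow (z : ℝ≥0∞) : ∀ n,
    Measurable fun p : ℝ × (Vertex → ℝ) => truncPow z n p.1 p.2
  | 0 => measurable_const
  | n + 1 => by
    have h : ∀ b, Measurable fun p : ℝ × (Vertex → ℝ) => (p.1 - p.2 [], subClocks p.2 b) := by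
      intro b
      unfold subClocks
      fun_prop
    exact Measurable.ite (measurableSet_lt measurable_fst (by fun_prop)) measurable_const
      (((measurable_truncPow z n).comp (h false)).mul ((measurable_truncPow z n).comp (h true)))

theorem truncPow_le_one {z : ℝ≥0∞} (hz : z ≤ 1) : ∀ n t c, truncPow z n t c ≤ 1
  | 0, _, _ => le_rfl
  | n + 1, t, c => by
    rw [truncPow]
    split_ifs
    · exact hz
    · exact mul_le_one' (truncPow_le_one hz _ _ _) (truncPow_le_one hz _ _ _)

/-- The living vertices counted by `truncPow` are collected along the recursion; the two subtrees
contribute disjoint sets, so exponents add. Finiteness of the whole population is not needed. -/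
theorem exists_pow_card_le_truncPow (z : ℝ≥0∞) : ∀ (n : ℕ) (t : ℝ) (c : Vertex → ℝ), 0 ≤ t →
    ∃ F : Finset Vertex, (∀ v ∈ F, ClockAlive c t v) ∧ z ^ F.card ≤ truncPow z n t c
  | 0, _, _, _ => ⟨∅, by simp, by simp [truncPow]⟩
  | n + 1, t, c, ht => by
    rw [truncPow]
    split_ifs with h
    · exact ⟨{[]}, by simpa using ⟨ht, h⟩, by simp⟩
    · obtain ⟨F, hF, hF'⟩ := exists_pow_card_le_truncPow z n (t - c []) (subClocks c false)
        (by linarith)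
      obtain ⟨G, hG, hG'⟩ := exists_pow_card_le_truncPow z n (t - c []) (subClocks c true)
        (by linarith)
      refine ⟨F.image (· ++ [false]) ∪ G.image (· ++ [true]), ?_, ?_⟩
      · intro v hv
        rcases Finset.mem_union.1 hv with hv | hv <;> obtain ⟨l, hl, rfl⟩ := Finset.mem_image.1 hv
        · exact (clockAlive_append _ _ _ _).2 (hF l hl)
        · exact (clockAlive_append _ _ _ _).2 (hG l hl)
      · have hd : Disjoint (F.image (· ++ [false])) (G.image (· ++ [true])) := by
          rw [Finset.disjoint_left]
          intro v hv hv'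
          obtain ⟨l, -, rfl⟩ := Finset.mem_image.1 hv
          obtain ⟨l', -, h⟩ := Finset.mem_image.1 hv'
          simpa using congrArg List.getLast? h
        rw [Finset.card_union_of_disjoint hd,
          Finset.card_image_of_injective _ (List.append_left_injective _),
          Finset.card_image_of_injective _ (List.append_left_injective _), pow_add]
        exact mul_le_mul' hF' hG'

/-- Decomposition at the first split: after it, the two subtrees are independent copies with the
remaining time `t - a`. -/
theorem lintegral_truncPow_succ (z : ℝ≥0∞) (n : ℕ) (t : ℝ) :
    ∫⁻ c, truncPow z (n + 1) t c ∂clockLaw =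
      ∫⁻ a, (if t < a then z else (∫⁻ c, truncPow z n (t - a) c ∂clockLaw) ^ 2) ∂(expMeasure 1) := by
  have hm : Measurable fun c => truncPow z (n + 1) t c :=
    (measurable_truncPow z (n + 1)).comp measurable_prodMk_left
  rw [lintegral_clockLaw hm]
  refine lintegral_congr fun a => ?_
  have h : ∀ f g, truncPow z (n + 1) t (joinClocks (a, f, g)) =
      if t < a then z else truncPow z n (t - a) f * truncPow z n (t - a) g := by
    intro f g
    have h0 : subClocks (joinClocks (a, f, g)) false = f := by
      ext v; simp [subClocks, joinClocks]
    have h1 : subClocks (joinClocks (a, f, g)) true = g := by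
      ext v; simp [subClocks, joinClocks]
    have h2 : joinClocks (a, f, g) [] = a := rfl
    rw [truncPow, h0, h1, h2]
  simp only [h]
  split_ifs
  · simp
  · have hn : Measurable fun c => truncPow z n (t - a) c :=
      (measurable_truncPow z n).comp measurable_prodMk_left
    simp only [lintegral_const_mul _ hn, lintegral_mul_const _ hn, sq]

/-- The generating function of the geometric law of the number of vertices at time `t`. -/
noncomputable def yuleGen (κ t : ℝ) : ℝ := 1 / (1 + κ * Real.exp t)

/-- This logistic equation is the differential form of the decomposition at the first split. -/
theorem hasDerivAt_yuleGen {κ : ℝ} (hκ : 0 < κ) (t : ℝ) :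
    HasDerivAt (yuleGen κ) (-yuleGen κ t + yuleGen κ t ^ 2) t := by
  have hp : 1 + κ * Real.exp t ≠ 0 := by positivity
  have h := (((Real.hasDerivAt_exp t).const_mul κ).const_add 1).inv hp
  have he : yuleGen κ = (fun x => 1 + κ * Real.exp x)⁻¹ := by
    ext x; simp [yuleGen]
  rw [he]
  refine h.congr_deriv ?_
  simp only [Pi.inv_apply]
  field_simp
  ring

theorem yuleGen_pos {κ : ℝ} (hκ : 0 < κ) (t : ℝ) : 0 < yuleGen κ t := by
  unfold yuleGen; positivity

theorem yuleGen_le_one {κ : ℝ} (hκ : 0 < κ) (t : ℝ) : yuleGen κ t ≤ 1 := by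
  unfold yuleGen
  rw [div_le_one (by positivity)]
  have := mul_pos hκ (Real.exp_pos t)
  linarith

theorem yuleGen_recursion_integral {κ t : ℝ} (hκ : 0 < κ) (n : ℕ) :
    ∫ s in (0 : ℝ)..t, (Real.exp (-s) * yuleGen κ (t - s) ^ 2 +
      2 * ((2 * (t - s)) ^ n / n.factorial)) =
    yuleGen κ t - Real.exp (-t) * yuleGen κ 0 + (2 * t) ^ (n + 1) / (n + 1).factorial := by
  have hcont : Continuous (yuleGen κ) :=
    continuous_iff_continuousAt.2 fun x => (hasDerivAt_yuleGen hκ x).continuousAt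
  -- By the logistic equation, the derivative of -e^(-s) y(t-s) is e^(-s) y(t-s)^2.
  have hd : ∀ s ∈ Set.uIcc 0 t, HasDerivAt
      (fun s => -(Real.exp (-s) * yuleGen κ (t - s)) -
        (2 * (t - s)) ^ (n + 1) / (n + 1).factorial)
      (Real.exp (-s) * yuleGen κ (t - s) ^ 2 + 2 * ((2 * (t - s)) ^ n / n.factorial)) s := by
    intro s _
    have h0 : HasDerivAt (fun s : ℝ => t - s) (-1) s := (hasDerivAt_id s).const_sub t
    have h1 : HasDerivAt (fun s : ℝ => Real.exp (-s)) (Real.exp (-s) * -1) s :=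
      (hasDerivAt_neg s).exp
    have h2 := (hasDerivAt_yuleGen hκ (t - s)).comp s h0
    have h3 := ((h0.const_mul 2).pow (n + 1)).div_const ((n + 1).factorial : ℝ)
    refine ((h1.mul h2).neg.sub h3).congr_deriv ?_
    have hf : (n.factorial : ℝ) ≠ 0 := by positivity
    have hn : (n : ℝ) + 1 ≠ 0 := by positivity
    rw [Nat.factorial_succ]
    push_cast
    simp only [Function.comp]
    field_simp
    ring
  rw [intervalIntegral.integral_eq_sub_of_hasDerivAt hd
    (Continuous.intervalIntegrable (by fun_prop) _ _)]
  simp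
  ring

/-- The truncated generating function obeys the recursion of `yuleGen`, only started from 1 at `n =
0`. Squaring has Lipschitz constant 2 on [0,1], so n iterated integrations shrink the initial error
to (2t)^n / n!. -/
theorem lintegral_truncPow_le {κ : ℝ} (hκ : 0 < κ) : ∀ (n : ℕ) {t : ℝ}, 0 ≤ t →
    ∫⁻ c, truncPow (ENNReal.ofReal (1 / (1 + κ))) n t c ∂clockLaw ≤
      ENNReal.ofReal (yuleGen κ t + (2 * t) ^ n / n.factorial)
  | 0, t, _ => by
    have := yuleGen_pos hκ t
    simp only [truncPow, lintegral_const, measure_univ, mul_one, pow_zero, Nat.factorial_zero,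
      Nat.cast_one, div_one]
    rw [← ENNReal.ofReal_one]
    exact ENNReal.ofReal_le_ofReal (by linarith)
  | n + 1, t, ht => by
    set z : ℝ≥0∞ := ENNReal.ofReal (1 / (1 + κ)) with hz
    have hz1 : z ≤ 1 := by
      rw [hz, ← ENNReal.ofReal_one]
      refine ENNReal.ofReal_le_ofReal ?_
      rw [div_le_one (by positivity)]
      linarith
    have hm : Measurable fun a => ∫⁻ c, truncPow z n (t - a) c ∂clockLaw := by
      have : Measurable fun p : ℝ × (Vertex → ℝ) => truncPow z n (t - p.1) p.2 :=
        (measurable_truncPow z n).comp (by fun_prop : Measurable fun p : ℝ × (Vertex → ℝ) =>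
          (t - p.1, p.2))
      exact this.lintegral_prod_right'
    have hbound : ∀ s ∈ Set.Icc 0 t, (∫⁻ c, truncPow z n (t - s) c ∂clockLaw) ^ 2 ≤
        ENNReal.ofReal (yuleGen κ (t - s) ^ 2 + 2 * ((2 * (t - s)) ^ n / n.factorial)) := by
      intro s hs
      have h1 := lintegral_truncPow_le hκ n (t := t - s) (by linarith [hs.2])
      have h2 : ∫⁻ c, truncPow z n (t - s) c ∂clockLaw ≤ 1 := by
        calc _ ≤ ∫⁻ _, 1 ∂clockLaw := lintegral_mono fun c => truncPow_le_one hz1 _ _ _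
          _ = 1 := by simp
      set e := ∫⁻ c, truncPow z n (t - s) c ∂clockLaw
      have hfin : e ≠ ⊤ := ne_top_of_le_ne_top ENNReal.one_ne_top h2
      have h0 := yuleGen_pos hκ (t - s)
      have h3 := yuleGen_le_one hκ (t - s)
      have hD : 0 ≤ (2 * (t - s)) ^ n / (n.factorial : ℝ) :=
        div_nonneg (pow_nonneg (by linarith [hs.2]) _) (by positivity)
      have h4 : e.toReal ≤ yuleGen κ (t - s) + (2 * (t - s)) ^ n / n.factorial :=
        ENNReal.toReal_le_of_le_ofReal (by positivity) h1
      have h5 : e.toReal ≤ 1 := by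
        simpa using ENNReal.toReal_mono ENNReal.one_ne_top h2
      have h6 : 0 ≤ e.toReal := ENNReal.toReal_nonneg
      rw [← ENNReal.ofReal_toReal hfin, ← ENNReal.ofReal_pow h6]
      refine ENNReal.ofReal_le_ofReal ?_
      -- If e exceeds y, then e^2 - y^2 = (e - y)(e + y) ≤ 2(e - y), since both are at most 1.
      by_cases hle : e.toReal ≤ yuleGen κ (t - s)
      · nlinarith
      · push Not at hle
        nlinarith
    rw [lintegral_truncPow_succ]
    have hsplit : ∀ a, (if t < a then z else (∫⁻ c, truncPow z n (t - a) c ∂clockLaw) ^ 2) ≤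
        (Set.Ioi t).indicator (fun _ => z) a +
        (Set.Iic t).indicator (fun a => (∫⁻ c, truncPow z n (t - a) c ∂clockLaw) ^ 2) a := by
      intro a
      by_cases h : t < a
      · simp [h]
      · simp [h, not_lt.1 h]
    have hm2 : Measurable ((Set.Iic t).indicator fun a =>
        (∫⁻ c, truncPow z n (t - a) c ∂clockLaw) ^ 2) := (hm.pow_const 2).indicator measurableSet_Iic
    refine (lintegral_mono hsplit).trans ?_
    rw [lintegral_add_right _ hm2, lintegral_indicator_const measurableSet_Ioi,
      expMeasure_one_Ioi ht, lintegral_expMeasure_one hm2]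
    have hI : ∫⁻ x in Set.Ici 0, ENNReal.ofReal (Real.exp (-x)) * (Set.Iic t).indicator
        (fun a => (∫⁻ c, truncPow z n (t - a) c ∂clockLaw) ^ 2) x ≤
        ∫⁻ x in Set.Ioc 0 t, ENNReal.ofReal (Real.exp (-x) * yuleGen κ (t - x) ^ 2 +
          2 * ((2 * (t - x)) ^ n / n.factorial)) := by
      rw [← restrict_Ioi_eq_restrict_Ici, ← lintegral_indicator measurableSet_Ioi,
        ← lintegral_indicator measurableSet_Ioc]
      refine lintegral_mono fun x => ?_
      by_cases h : x ∈ Set.Ioc 0 t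
      · have hx : x ∈ Set.Icc 0 t := ⟨h.1.le, h.2⟩
        have hD : 0 ≤ (2 * (t - x)) ^ n / (n.factorial : ℝ) :=
          div_nonneg (pow_nonneg (by linarith [h.2]) _) (by positivity)
        have h1 : Real.exp (-x) ≤ 1 := Real.exp_le_one_iff.2 (by linarith [h.1])
        rw [Set.indicator_of_mem (show x ∈ Set.Ioi 0 from h.1), Set.indicator_of_mem h,
          Set.indicator_of_mem (show x ∈ Set.Iic t from h.2)]
        calc _ ≤ ENNReal.ofReal (Real.exp (-x)) * _ := mul_le_mul_right (hbound x hx) _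
          _ = _ := (ENNReal.ofReal_mul (Real.exp_pos _).le).symm
          _ ≤ _ := ENNReal.ofReal_le_ofReal (by nlinarith [Real.exp_pos (-x)])
      · rw [Set.indicator_of_notMem h]
        by_cases h0 : 0 < x
        · have : x ∉ Set.Iic t := fun h' => h ⟨h0, h'⟩
          simp [this]
        · simp [h0]
    refine (add_le_add_right hI _).trans ?_
    have hcont : Continuous (yuleGen κ) :=
      continuous_iff_continuousAt.2 fun x => (hasDerivAt_yuleGen hκ x).continuousAt
    rw [← ofReal_integral_eq_lintegral_ofReal, ← intervalIntegral.integral_of_le ht,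
      yuleGen_recursion_integral hκ, hz, ← ENNReal.ofReal_mul (by positivity),
      ← ENNReal.ofReal_add (by positivity)]
    · refine ENNReal.ofReal_le_ofReal (le_of_eq ?_)
      simp only [yuleGen, Real.exp_zero, mul_one]
      ring
    · have h0 := yuleGen_recursion_integral (t := t) hκ n
      rw [← h0]
      refine intervalIntegral.integral_nonneg ht fun s hs => ?_
      have hD : 0 ≤ (2 * (t - s)) ^ n / (n.factorial : ℝ) :=
        div_nonneg (pow_nonneg (by linarith [hs.2]) _) (by positivity)
      positivity
    · exact (Continuous.integrableOn_Icc (by fun_prop)).mono_set Set.Ioc_subset_Icc_self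
    · refine (ae_restrict_iff' measurableSet_Ioc).2 (Eventually.of_forall fun s hs => ?_)
      have hD : 0 ≤ (2 * (t - s)) ^ n / (n.factorial : ℝ) :=
        div_nonneg (pow_nonneg (by linarith [hs.2]) _) (by positivity)
      simp only [Pi.zero_apply]
      positivity

/-- The lower tail of the number of vertices at time `t`. -/
theorem clockLaw_few_alive_le {κ t : ℝ} (hκ : 0 < κ) (ht : 0 ≤ t) (M : ℕ) :
    clockLaw {c | ¬ ∃ F : Finset Vertex, F.card = M ∧ ∀ v ∈ F, ClockAlive c t v} ≤
      ENNReal.ofReal ((1 + κ) ^ M * yuleGen κ t) := by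
  set z : ℝ≥0∞ := ENNReal.ofReal (1 / (1 + κ)) with hz
  have hz1 : z ≤ 1 := by
    rw [hz, ← ENNReal.ofReal_one]
    refine ENNReal.ofReal_le_ofReal ?_
    rw [div_le_one (by positivity)]
    linarith
  have hn : ∀ n : ℕ, z ^ M *
      clockLaw {c | ¬ ∃ F : Finset Vertex, F.card = M ∧ ∀ v ∈ F, ClockAlive c t v} ≤
      ENNReal.ofReal (yuleGen κ t + (2 * t) ^ n / n.factorial) := by
    intro n
    refine le_trans ?_ (lintegral_truncPow_le hκ n ht)
    have hm : Measurable fun c => truncPow z n t c :=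
      (measurable_truncPow z n).comp measurable_prodMk_left
    refine le_trans ?_ (mul_meas_ge_le_lintegral hm (z ^ M))
    refine mul_le_mul_right (measure_mono fun c hc => ?_) _
    obtain ⟨F, hF, hF'⟩ := exists_pow_card_le_truncPow z n t c ht
    refine le_trans (pow_le_pow_right_of_le_one' hz1 ?_) hF'
    by_contra hlt
    push Not at hlt
    obtain ⟨G, hG, hG'⟩ := Finset.exists_subset_card_eq hlt.le
    exact hc ⟨G, hG', fun v hv => hF v (hG hv)⟩
  -- The Markov bound holds for every truncation depth, and its right side loses the error term in
  -- the limit.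
  have hlim : Tendsto (fun n : ℕ => ENNReal.ofReal (yuleGen κ t + (2 * t) ^ n / n.factorial)) atTop
      (𝓝 (ENNReal.ofReal (yuleGen κ t + 0))) :=
    ENNReal.tendsto_ofReal (tendsto_const_nhds.add (FloorSemiring.tendsto_pow_div_factorial_atTop _))
  have h := ge_of_tendsto' hlim hn
  rw [add_zero] at h
  have hinv : ENNReal.ofReal ((1 + κ) ^ M) * z ^ M = 1 := by
    rw [hz, ← ENNReal.ofReal_pow (by positivity), ← ENNReal.ofReal_mul (by positivity), ← mul_pow,
      mul_one_div_cancel (by positivity), one_pow, ENNReal.ofReal_one]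
  calc _ = ENNReal.ofReal ((1 + κ) ^ M) * (z ^ M * clockLaw
        {c | ¬ ∃ F : Finset Vertex, F.card = M ∧ ∀ v ∈ F, ClockAlive c t v}) := by
        rw [← mul_assoc, hinv, one_mul]
    _ ≤ _ := by
      rw [ENNReal.ofReal_mul (by positivity)]
      exact mul_le_mul_right h _

/-! ### Connectedness of the truncated graphs, for fixed clocks and marks -/

section

variable {ω : Sample} {t : ℝ}

theorem birthTime_le_splitTime (hpos : ∀ v, 0 < ω.1 v) (v : Vertex) :
    birthTime ω v ≤ splitTime ω v := by
  cases v with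
  | nil => exact (hpos []).le
  | cons b v => exact le_add_of_nonneg_right (hpos _).le

theorem splitTime_le_birthTime (hpos : ∀ v, 0 < ω.1 v) {u : Vertex} : ∀ {v : Vertex},
    u <:+ v → u ≠ v → splitTime ω u ≤ birthTime ω v
  | [], h, hne => absurd (List.suffix_nil.1 h) hne
  | b :: v, h, hne => by
    rcases List.suffix_cons_iff.1 h with h | h
    · exact absurd h hne
    · by_cases huv : u = v
      · rw [huv]; rfl
      · exact (splitTime_le_birthTime hpos h huv).trans (birthTime_le_splitTime hpos v)

theorem birthTime_mono (hpos : ∀ v, 0 < ω.1 v) {u v : Vertex} (h : u <:+ v) :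
    birthTime ω u ≤ birthTime ω v := by
  by_cases huv : u = v
  · rw [huv]
  · exact (birthTime_le_splitTime hpos u).trans (splitTime_le_birthTime hpos h huv)

theorem Visits.birthTime_le {e : Edge} {b : Bool} {x : Vertex} (h : Visits ω t e b x) :
    birthTime ω x ≤ t := by
  cases h with
  | start h _ => exact h
  | move _ h => exact h

/-- Times are forgotten here: what remains is a route, which depends on the marks alone. -/
theorem Visits.follow {e : Edge} {b : Bool} {x : Vertex} (h : Visits ω t e b x) :
    e.2 < newEdges ω e.1 ∧ ∃ l, x = l ++ b :: e.1 ∧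
      Follow (fun w => ω.2.2 (e, w)) (b :: e.1) l := by
  induction h with
  | start _ h => exact ⟨h, [], rfl, trivial⟩
  | @move w _ _ ih =>
    obtain ⟨h, l, rfl, hl⟩ := ih
    exact ⟨h, ω.2.2 (e, l ++ b :: e.1) :: l, rfl, hl, rfl⟩

/-- Conversely, positive clocks ensure that all splits along a route have occurred once its last
vertex is born, so the route is travelled in full. -/
theorem Visits.of_follow (hpos : ∀ v, 0 < ω.1 v) {e : Edge} {b : Bool} {a : Vertex}
    (h : Visits ω t e b a) : ∀ {l : Vertex}, Follow (fun w => ω.2.2 (e, w)) a l →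
      birthTime ω (l ++ a) ≤ t → Visits ω t e b (l ++ a)
  | [], _, _ => h
  | c :: l, hl, hb => by
    have hs : splitTime ω (l ++ a) ≤ t := hb
    have h1 := (h.of_follow hpos hl.1 ((birthTime_le_splitTime hpos _).trans hs)).move hs
    have h2 : heir ω e (l ++ a) = c :: (l ++ a) := congrArg (· :: (l ++ a)) hl.2
    rwa [h2] at h1

/-- The vertex `x` is present at time `t` if no vertex of length `n` is allowed to split. -/
def TruncAlive (ω : Sample) (t : ℝ) (n : ℕ) (x : Vertex) : Prop :=
  x.length ≤ n ∧ birthTime ω x ≤ t ∧ (t < splitTime ω x ∨ x.length = n)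

/-- Adjacency at time `t` if no vertex of length `n` is allowed to split. -/
def TruncAdj (ω : Sample) (t : ℝ) (n : ℕ) (x y : Vertex) : Prop :=
  ∃ e b, (Visits ω t e b x ∧ TruncAlive ω t n x) ∧ (Visits ω t e (!b) y ∧ TruncAlive ω t n y)

theorem TruncAdj.symm {n : ℕ} {x y : Vertex} (h : TruncAdj ω t n x y) : TruncAdj ω t n y x := by
  obtain ⟨e, b, h1, h2⟩ := h
  exact ⟨e, !b, h2, by rwa [Bool.not_not]⟩

/-- Being joined by a walk at time `t` if no vertex of length `n` is allowed to split. -/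
def TruncReach (ω : Sample) (t : ℝ) (n : ℕ) : Vertex → Vertex → Prop :=
  Relation.ReflTransGen (TruncAdj ω t n)

theorem TruncReach.symm {n : ℕ} {x y : Vertex} (h : TruncReach ω t n x y) :
    TruncReach ω t n y x :=
  Relation.ReflTransGen.mono (fun _ _ h => TruncAdj.symm h) _ _ (Relation.ReflTransGen.swap _ _ h)

theorem exists_truncAlive {n : ℕ} (w : Vertex) (hw : w.length ≤ n) (hb : birthTime ω w ≤ t) :
    ∃ x, w <:+ x ∧ TruncAlive ω t n x := by
  by_cases h : t < splitTime ω w ∨ w.length = n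
  · exact ⟨w, List.suffix_rfl, hw, hb, h⟩
  · push Not at h
    have hlt : w.length < n := lt_of_le_of_ne hw h.2
    obtain ⟨x, hx, hx'⟩ := exists_truncAlive (n := n) (true :: w) (by simpa using hlt) h.1
    exact ⟨x, (List.suffix_cons _ _).trans hx, hx'⟩
  termination_by n - w.length
  decreasing_by simp; omega

theorem Visits.exists_truncAlive {n : ℕ} {e : Edge} {b : Bool} {w : Vertex}
    (h : Visits ω t e b w) (hw : w.length ≤ n) :
    ∃ x, w <:+ x ∧ Visits ω t e b x ∧ TruncAlive ω t n x := by
  by_cases h' : t < splitTime ω w ∨ w.length = n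
  · exact ⟨w, List.suffix_rfl, h, hw, h.birthTime_le, h'⟩
  · push Not at h'
    have hlt : w.length < n := lt_of_le_of_ne hw h'.2
    obtain ⟨x, hx, hx'⟩ := (h.move h'.1).exists_truncAlive (n := n) (by simpa [heir] using hlt)
    exact ⟨x, (List.suffix_cons _ _).trans hx, hx'⟩
  termination_by n - w.length
  decreasing_by simp [heir]; omega

/-- A subtree all of whose splits add an edge is connected. -/
theorem truncReach_of_newEdges (hpos : ∀ v, 0 < ω.1 v) {n : ℕ} (q : Vertex)
    (hN : ∀ w, q <:+ w → w.length < n → 0 < newEdges ω w) {x y : Vertex}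
    (hx : TruncAlive ω t n x) (hy : TruncAlive ω t n y) (hqx : q <:+ x) (hqy : q <:+ y) :
    TruncReach ω t n x y := by
  have hqn : q.length ≤ n := hqx.length_le.trans hx.1
  by_cases h : t < splitTime ω q ∨ q.length = n
  -- If `q` does not split in the truncated process, it is the only vertex of its subtree.
  · have key : ∀ {z}, TruncAlive ω t n z → q <:+ z → z = q := by
      intro z hz hqz
      by_contra hne
      rcases h with h | h
      · exact absurd (splitTime_le_birthTime hpos hqz (Ne.symm hne)) (by linarith [hz.2.1])
      · exact hne (hqz.eq_of_length_le (by rw [h]; exact hz.1)).symm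
    rw [key hx hqx, key hy hqy]
    exact Relation.ReflTransGen.refl
  · push Not at h
    have hlt : q.length < n := lt_of_le_of_ne hqn h.2
    have hq : 0 < newEdges ω q := hN q List.suffix_rfl hlt
    -- The edge number 0 added at `q` keeps one end in each of the two subtrees and links them.
    have hland : ∀ b : Bool, ∃ z, (b :: q) <:+ z ∧ Visits ω t (q, 0) b z ∧ TruncAlive ω t n z :=
      fun b => (Visits.start (e := (q, 0)) h.1 hq).exists_truncAlive (by simpa using hlt)
    choose z hz1 hz2 hz3 using hland
    have hadj : ∀ b c, TruncReach ω t n (z b) (z c) := by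
      intro b c
      by_cases hbc : c = b
      · rw [hbc]; exact Relation.ReflTransGen.refl
      · have hc : c = !b := by cases b <;> cases c <;> simp_all
        subst hc
        exact Relation.ReflTransGen.single ⟨(q, 0), b, ⟨hz2 b, hz3 b⟩, ⟨hz2 _, hz3 _⟩⟩
    have hside : ∀ {w}, TruncAlive ω t n w → q <:+ w → ∃ b, TruncReach ω t n w (z b) := by
      intro w hw hqw
      obtain ⟨l, rfl⟩ := hqw
      rcases List.eq_nil_or_concat l with rfl | ⟨l, b, rfl⟩
      · rcases hw.2.2 with h' | h'
        · exact absurd h' (by simpa using h.1)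
        · exact absurd h' (by simpa using h.2)
      · have hs : (b :: q) <:+ l.concat b ++ q := ⟨l, by simp⟩
        exact ⟨b, truncReach_of_newEdges hpos (b :: q)
          (fun w hw => hN w ((List.suffix_cons _ _).trans hw)) hw (hz3 b) hs (hz1 b)⟩
    obtain ⟨b, hb⟩ := hside hx hqx
    obtain ⟨c, hc⟩ := hside hy hqy
    exact (Relation.ReflTransGen.trans hb (hadj b c)).trans hc.symm
  termination_by n - q.length
  decreasing_by simp; omega

/-- Connectedness at time `t` if no vertex of length `n` is allowed to split. -/
def TruncConn (ω : Sample) (t : ℝ) (n : ℕ) : Prop :=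
  ∀ x y, TruncAlive ω t n x → TruncAlive ω t n y → TruncReach ω t n x y

theorem truncConn_zero : TruncConn ω t 0 := by
  intro x y hx hy
  rw [List.length_eq_zero_iff.1 (Nat.le_zero.1 hx.1), List.length_eq_zero_iff.1 (Nat.le_zero.1 hy.1)]
  exact Relation.ReflTransGen.refl

/-- Contracting the sibling pairs of generation `n + 1` gives back the graph truncated at `n`. Each
of its edges lifts, since an end at a splitting vertex moves to one of the two offspring; `hsib`
supplies the passages between siblings, so walks lift too. -/
theorem TruncConn.succ (hpos : ∀ v, 0 < ω.1 v) {n : ℕ} (h : TruncConn ω t n)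
    (hsib : ∀ v : Vertex, v.length = n → splitTime ω v ≤ t →
      TruncReach ω t (n + 1) (false :: v) (true :: v)) : TruncConn ω t (n + 1) := by
  -- The fibres of this contraction: a surviving vertex lies over itself, the offspring of a split
  -- vertex of length `n` over their parent.
  let Over : Vertex → Vertex → Prop := fun a x =>
    (x = a ∧ t < splitTime ω a) ∨ ((∃ b, x = b :: a) ∧ a.length = n ∧ splitTime ω a ≤ t)
  have hproj : ∀ x, TruncAlive ω t (n + 1) x → ∃ a, TruncAlive ω t n a ∧ Over a x := by
    intro x hx
    by_cases hl : x.length ≤ n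
    · have hs : t < splitTime ω x := hx.2.2.resolve_right (by omega)
      exact ⟨x, ⟨hl, hx.2.1, Or.inl hs⟩, Or.inl ⟨rfl, hs⟩⟩
    · cases x with
      | nil => simp at hl
      | cons b a =>
        have h1 := hx.1
        simp only [List.length_cons] at h1 hl
        have hs : splitTime ω a ≤ t := hx.2.1
        have hn : a.length = n := by omega
        exact ⟨a, ⟨hn.le, (birthTime_le_splitTime hpos a).trans hs, Or.inr hn⟩,
          Or.inr ⟨⟨b, rfl⟩, hn, hs⟩⟩
  have hfib : ∀ a x y, Over a x → Over a y → TruncReach ω t (n + 1) x y := by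
    rintro a x y (⟨rfl, h1⟩ | ⟨⟨b, rfl⟩, hn, h1⟩) (⟨rfl, h2⟩ | ⟨⟨c, rfl⟩, -, h2⟩)
    · exact Relation.ReflTransGen.refl
    · exact absurd h1 (not_lt.2 h2)
    · exact absurd h2 (not_lt.2 h1)
    · have := hsib a hn h1
      cases b <;> cases c
      · exact Relation.ReflTransGen.refl
      · exact this
      · exact this.symm
      · exact Relation.ReflTransGen.refl
  have hlift : ∀ e b a, Visits ω t e b a → TruncAlive ω t n a →
      ∃ x, Over a x ∧ Visits ω t e b x ∧ TruncAlive ω t (n + 1) x := by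
    intro e b a hv ha
    by_cases hs : t < splitTime ω a
    · exact ⟨a, Or.inl ⟨rfl, hs⟩, hv, ha.1.trans (Nat.le_succ n), ha.2.1, Or.inl hs⟩
    · have hn := ha.2.2.resolve_left hs
      push Not at hs
      exact ⟨heir ω e a, Or.inr ⟨⟨_, rfl⟩, hn, hs⟩, hv.move hs, by simp [heir, hn],
        hs, Or.inr (by simp [heir, hn])⟩
  intro x y hx hy
  obtain ⟨a, ha, hax⟩ := hproj x hx
  obtain ⟨a', ha', hay⟩ := hproj y hy
  have key : ∀ a', TruncReach ω t n a a' → ∀ y, Over a' y → TruncReach ω t (n + 1) x y := by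
    intro a' hr
    induction hr with
    | refl => exact fun y hy => hfib a x y hax hy
    | tail _ hadj ih =>
      intro y hy
      obtain ⟨e, b, ⟨h1, h2⟩, ⟨h3, h4⟩⟩ := hadj
      obtain ⟨z, hz1, hz2⟩ := hlift e b _ h1 h2
      obtain ⟨z', hz1', hz2'⟩ := hlift e (!b) _ h3 h4
      exact (Relation.ReflTransGen.tail (ih z hz1) ⟨e, b, hz2, hz2'⟩).trans (hfib _ _ _ hz1' hy)
  exact key a' (h a a' ha ha') y hay

/-- By `hn` nobody of generation `n` is born by time `t`, so truncation at `n` changes nothing, and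
the induction over generations reaches the true graph. -/
theorem isConnected_of_siblings (hpos : ∀ v, 0 < ω.1 v) (ht : 0 ≤ t) {n : ℕ}
    (hn : ∀ v : Vertex, v.length = n → t < birthTime ω v)
    (hsib : ∀ v : Vertex, splitTime ω v ≤ t →
      TruncReach ω t (v.length + 1) (false :: v) (true :: v)) :
    IsConnected (graphAt ω t) := by
  have hconn : ∀ m, TruncConn ω t m := by
    intro m
    induction m with
    | zero => exact truncConn_zero
    | succ m ih => exact ih.succ hpos fun v hv hs => by simpa [hv] using hsib v hs
  have halive : ∀ x, TruncAlive ω t n x ↔ Alive ω t x := by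
    intro x
    constructor
    · rintro ⟨_, h1, h2 | h2⟩
      · exact ⟨h1, h2⟩
      · exact absurd h1 (not_le.2 (hn x h2))
    · rintro ⟨h1, h2⟩
      refine ⟨?_, h1, Or.inl h2⟩
      by_contra hlt
      push Not at hlt
      -- A living vertex longer than `n` would have an ancestor of length exactly `n`, born no
      -- later.
      have h3 := hn (x.drop (x.length - n)) (by simp; omega)
      have h4 := birthTime_mono hpos (List.drop_suffix (x.length - n) x)
      linarith
  refine ⟨?_, fun x hx y hy => ?_⟩
  · obtain ⟨x, -, hx⟩ := exists_truncAlive (ω := ω) (t := t) (n := n) [] (by simp) ht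
    exact ⟨x, (halive x).1 hx⟩
  · refine Relation.ReflTransGen.mono ?_ _ _ (hconn n x y ((halive x).2 hx) ((halive y).2 hy))
    rintro a b ⟨e, c, ⟨h1, h2⟩, ⟨h3, h4⟩⟩
    exact ⟨e, c, ⟨h1, (halive a).1 h2⟩, ⟨h3, (halive b).1 h4⟩⟩

theorem truncReach_siblings_of_newEdges {v : Vertex}
    (hs : splitTime ω v ≤ t) (hN : 0 < newEdges ω v) :
    TruncReach ω t (v.length + 1) (false :: v) (true :: v) := by
  have h : ∀ b, Visits ω t (v, 0) b (b :: v) := fun b => Visits.start (e := (v, 0)) hs hN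
  have h' : ∀ b, TruncAlive ω t (v.length + 1) (b :: v) := fun b =>
    ⟨by simp, hs, Or.inr (by simp)⟩
  exact Relation.ReflTransGen.single ⟨(v, 0), false, ⟨h _, h' _⟩, ⟨h _, h' _⟩⟩

/-- Two siblings are joined by a walk if some subtree that hangs off their line of ancestors is
connected and receives an edge from both. -/
theorem truncReach_siblings_of_subtree (hpos : ∀ v, 0 < ω.1 v) {v p l : Vertex} {b : Bool}
    (hv : v = l ++ b :: p) (hs : splitTime ω v ≤ t)
    (hedge : ∀ c, ∃ k < newEdges ω p, Follow (fun w => ω.2.2 ((p, k), w)) (b :: p) (c :: l))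
    (hN : ∀ w, ((!b) :: p) <:+ w → w.length ≤ v.length → 0 < newEdges ω w) :
    TruncReach ω t (v.length + 1) (false :: v) (true :: v) := by
  have hbp : (b :: p) <:+ v := ⟨l, hv.symm⟩
  have hp : splitTime ω p ≤ t := (birthTime_mono hpos hbp).trans
    ((birthTime_le_splitTime hpos v).trans hs)
  have h' : ∀ c, TruncAlive ω t (v.length + 1) (c :: v) := fun c =>
    ⟨by simp, hs, Or.inr (by simp)⟩
  have key : ∀ c, ∃ z, ((!b) :: p) <:+ z ∧ TruncAlive ω t (v.length + 1) z ∧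
      TruncAdj ω t (v.length + 1) (c :: v) z := by
    intro c
    obtain ⟨k, hk, hf⟩ := hedge c
    have h1 : Visits ω t (p, k) b ((c :: l) ++ b :: p) :=
      (Visits.start (e := (p, k)) (b := b) hp hk).of_follow hpos hf (by
        rw [List.cons_append, ← hv]; exact hs)
    rw [List.cons_append, ← hv] at h1
    have hle : ((!b) :: p).length ≤ v.length + 1 := by
      rw [hv]; simp; omega
    obtain ⟨z, hz, hz2, hz3⟩ :=
      (Visits.start (e := (p, k)) (b := !b) hp hk).exists_truncAlive hle
    exact ⟨z, hz, hz3, (p, k), b, ⟨h1, h' c⟩, ⟨hz2, hz3⟩⟩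
  obtain ⟨x, hx1, hx2, hx3⟩ := key false
  obtain ⟨y, hy1, hy2, hy3⟩ := key true
  have hxy : TruncReach ω t (v.length + 1) x y :=
    truncReach_of_newEdges hpos ((!b) :: p) (fun w hw hl => hN w hw (Nat.lt_succ_iff.1 hl))
      hx2 hy2 hx1 hy1
  exact (Relation.ReflTransGen.head hx3 hxy).tail hy3.symm

end

/-! ### Probability that a split separates its offspring -/

theorem markLaw_noEdge_of_injective (lam : ℝ≥0) {ι : Type*} [Fintype ι] {u : ι → Vertex}
    (hu : Function.Injective u) (Q : ι → Set (Vertex → Bool)) (hQ : ∀ i, MeasurableSet (Q i)) :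
    markLaw lam {η | ∀ i, η ∈ noEdge (u i) (Q i)} =
      ENNReal.ofReal (Real.exp (-(lam / 2 * ∑ i, choiceLaw.real (Q i)))) := by
  classical
  have hQ' : ∀ i, Function.extend u Q (fun _ => ∅) (u i) = Q i := fun i => hu.extend_apply _ _ i
  have h := markLaw_noEdge lam (Finset.univ.image u) (Function.extend u Q fun _ => ∅) (by
    intro v
    by_cases hv : ∃ i, u i = v
    · obtain ⟨i, rfl⟩ := hv
      rw [hQ']
      exact hQ i
    · rw [Function.extend_apply' _ _ _ hv]
      exact MeasurableSet.empty)
  rw [Finset.sum_image hu.injOn] at h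
  simp only [hQ'] at h
  rw [← h]
  congr 1
  ext η
  simp [hQ']

/-- The ways in which the `i`-th ancestor of a vertex may fail to provide a connection between
the offspring of this vertex: one of the offspring receives no edge, or there is a split without
new edges in the other subtree. -/
abbrev Failure (K : ℕ) : Type := Bool ⊕ (Σ j : Fin (K + 1), Fin j → Bool)

/-- The vertex whose split is responsible for a failure. -/
def failureSite {K : ℕ} (v : Vertex) (i : ℕ) : Failure K → Vertex
  | Sum.inl _ => v.drop (i + 1)
  | Sum.inr g => List.ofFn g.2 ++ (!(v.getD i false)) :: v.drop (i + 1)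

/-- The routes that no edge takes in case of a failure. -/
def failureSet {K : ℕ} (v : Vertex) (i : ℕ) : Failure K → Set (Vertex → Bool)
  | Sum.inl c => {χ | Follow χ (v.drop i) (c :: v.take i)}
  | Sum.inr _ => Set.univ

/-- The event that no edge is added when `v` splits and that none of the first `K` ancestors
provides a connection between the offspring of `v`. -/
def badMarks (K : ℕ) (v : Vertex) : Set Marks :=
  {η | η ∈ noEdge v Set.univ ∧
    ∀ i : Fin K, ∃ o : Failure K, η ∈ noEdge (failureSite v i o) (failureSet v i o)}

theorem drop_eq_getD_cons {v : Vertex} {i : ℕ} (hi : i < v.length) :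
    v.drop i = v.getD i false :: v.drop (i + 1) := by
  rw [List.drop_eq_getElem_cons hi, List.getD_eq_getElem _ _ hi]

theorem notMem_noEdge_univ {v : Vertex} {η : Marks} : η ∉ noEdge v Set.univ ↔ 0 < η.1 v := by
  simp only [noEdge, Set.mem_ofPred_eq, Set.mem_univ, not_true_eq_false, imp_false, not_forall,
    not_not]
  exact ⟨fun ⟨k, hk⟩ => (Nat.zero_le k).trans_lt hk, fun h => ⟨0, h⟩⟩

/-- If `v` itself adds no edge, some ancestor is free of every failure, and its other subtree is a
connected hub that sends edges to both offspring of `v`. -/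
theorem truncReach_siblings_of_notMem_badMarks {ω : Sample} {t : ℝ} (hpos : ∀ v, 0 < ω.1 v)
    {K : ℕ} {v : Vertex} (hK : K ≤ v.length) (hs : splitTime ω v ≤ t) (hb : ω.2 ∉ badMarks K v) :
    TruncReach ω t (v.length + 1) (false :: v) (true :: v) := by
  by_cases h0 : ω.2 ∈ noEdge v Set.univ
  · have h1 : ¬ ∀ i : Fin K, ∃ o : Failure K,
        ω.2 ∈ noEdge (failureSite v i o) (failureSet v i o) := fun h => hb ⟨h0, h⟩
    push Not at h1
    obtain ⟨i, hi⟩ := h1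
    have hiv : (i : ℕ) < v.length := i.2.trans_le hK
    have hd := drop_eq_getD_cons hiv
    refine truncReach_siblings_of_subtree hpos (l := v.take i) (b := v.getD i false)
      (p := v.drop (i + 1)) ?_ hs ?_ ?_
    · rw [← hd, List.take_append_drop]
    · intro c
      have := hi (Sum.inl c)
      simp only [noEdge, failureSite, failureSet, Set.mem_ofPred_eq, not_forall, not_not] at this
      obtain ⟨k, hk, h⟩ := this
      rw [hd] at h
      exact ⟨k, hk, h⟩
    · rintro w ⟨l, rfl⟩ hl
      -- A vertex of the other subtree that is no longer than `v` lies at most `i` levels below the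
      -- root of that subtree, so words of length at most `K` suffice.
      have hlK : l.length < K + 1 := by
        simp only [List.length_append, List.length_cons, List.length_drop] at hl
        have := i.2
        omega
      have := hi (Sum.inr ⟨⟨l.length, hlK⟩, l.get⟩)
      simp only [failureSite, failureSet, List.ofFn_get] at this
      exact notMem_noEdge_univ.1 this
  · exact truncReach_siblings_of_newEdges hs (notMem_noEdge_univ.1 h0)

theorem failureSite_suffix {K : ℕ} {v : Vertex} {i : ℕ} (o : Failure K) :
    v.drop (i + 1) <:+ failureSite v i o := by
  cases o with
  | inl c => exact List.suffix_rfl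
  | inr g => exact (List.suffix_cons _ _).trans (List.suffix_append _ _)

/-- The site of the `i`-th failure hangs below `v.drop (i + 1)` but off the line leading on to `v`.
This separates the sites of different ancestors, and from `v`. -/
theorem not_suffix_failureSite {K : ℕ} {v : Vertex} {i : ℕ} (hi : i < v.length) (o : Failure K) :
    ¬ v.drop i <:+ failureSite v i o := by
  rw [drop_eq_getD_cons hi]
  intro h
  cases o with
  | inl c => simpa [failureSite] using h.length_le
  | inr g =>
    have h2 := List.suffix_of_suffix_length_le h (List.suffix_append (List.ofFn g.2)
      ((!(v.getD i false)) :: v.drop (i + 1))) (by simp)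
    have h3 := h2.eq_of_length (by simp)
    simp at h3

/-- Union bound over the kinds of failure at the `K` ancestors. For fixed kinds the sites are
distinct and thinning gives the exponent (λ/2)(1 + ∑ 2^(-(i+1))); a missing edge at a split in the
other subtree costs a full λ/2, hence no less. -/
theorem markLaw_badMarks_le (lam : ℝ≥0) {K : ℕ} {v : Vertex} (hK : K ≤ v.length) :
    markLaw lam (badMarks K v) ≤ Fintype.card (Fin K → Failure K) *
      ENNReal.ofReal (Real.exp (-(lam * (1 - (1 / 2) ^ (K + 1))))) := by
  have hsub : badMarks K v ⊆ ⋃ f : Fin K → Failure K,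
      {η | ∀ j : Option (Fin K), η ∈ noEdge (j.elim v fun i => failureSite v i (f i))
        (j.elim Set.univ fun i => failureSet v i (f i))} := by
    rintro η ⟨h0, h1⟩
    choose f hf using h1
    refine Set.mem_iUnion.2 ⟨f, ?_⟩
    rintro (_ | i)
    · exact h0
    · exact hf i
  have hbound : ∀ f : Fin K → Failure K, markLaw lam
      {η | ∀ j : Option (Fin K), η ∈ noEdge (j.elim v fun i => failureSite v i (f i))
        (j.elim Set.univ fun i => failureSet v i (f i))} ≤
      ENNReal.ofReal (Real.exp (-(lam * (1 - (1 / 2) ^ (K + 1))))) := by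
    intro f
    have hlt : ∀ i : Fin K, (i : ℕ) < v.length := fun i => i.2.trans_le hK
    have hne : ∀ i : Fin K, failureSite v i (f i) ≠ v := fun i h =>
      not_suffix_failureSite (hlt i) (f i) (by rw [h]; exact List.drop_suffix _ _)
    have hne2 : ∀ i j : Fin K, i < j → failureSite v i (f i) ≠ failureSite v j (f j) := by
      intro i j hij h
      refine not_suffix_failureSite (hlt j) (f j) ?_
      rw [← h]
      refine List.IsSuffix.trans ?_ (failureSite_suffix (f i))
      obtain ⟨d, hd⟩ := Nat.exists_eq_add_of_le (Nat.succ_le_of_lt hij)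
      rw [hd, show (i : ℕ).succ + d = (i + 1) + d from rfl, ← List.drop_drop]
      exact List.drop_suffix _ _
    have hinj : Function.Injective
        (fun j : Option (Fin K) => j.elim v fun i => failureSite v i (f i)) := by
      rintro (_ | i) (_ | j) h
      · rfl
      · exact absurd h.symm (hne j)
      · exact absurd h (hne i)
      · rcases lt_trichotomy i j with hij | hij | hij
        · exact absurd h (hne2 i j hij)
        · rw [hij]
        · exact absurd h.symm (hne2 j i hij)
    rw [markLaw_noEdge_of_injective lam hinj]
    · refine ENNReal.ofReal_le_ofReal (Real.exp_le_exp.2 (neg_le_neg ?_))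
      have h1 : ∀ i : Fin K, (1 / 2 : ℝ) ^ ((i : ℕ) + 1) ≤
          choiceLaw.real (failureSet v i (f i)) := by
        intro i
        rcases f i with c | g
        · rw [failureSet, choiceLaw_follow, List.length_cons, List.length_take,
            min_eq_left (hlt i).le]
        · rw [failureSet, probReal_univ]
          exact pow_le_one₀ (by norm_num) (by norm_num)
      have h2 : ∑ i : Fin K, (1 / 2 : ℝ) ^ ((i : ℕ) + 1) = 1 - (1 / 2) ^ K := by
        rw [Fin.sum_univ_eq_sum_range (fun i => (1 / 2 : ℝ) ^ (i + 1))]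
        simp only [pow_succ, ← Finset.sum_mul]
        rw [geom_sum_eq (by norm_num)]
        ring
      have h3 := Finset.sum_le_sum fun (i : Fin K) (_ : i ∈ Finset.univ) => h1 i
      rw [h2] at h3
      rw [Fintype.sum_option]
      simp only [Option.elim, probReal_univ]
      have hl : (0 : ℝ) ≤ lam / 2 := by positivity
      calc (lam : ℝ) * (1 - (1 / 2) ^ (K + 1)) = lam / 2 * (1 + (1 - (1 / 2) ^ K)) := by ring
        _ ≤ _ := by gcongr
    · rintro (_ | i)
      · exact MeasurableSet.univ
      · simp only [Option.elim]
        rcases f i with c | g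
        · exact measurableSet_follow _ _
        · exact MeasurableSet.univ
  refine (measure_mono hsub).trans ((measure_iUnion_le _).trans ?_)
  rw [tsum_fintype]
  refine (Finset.sum_le_sum fun f _ => hbound f).trans ?_
  rw [Finset.sum_const, nsmul_eq_mul, Finset.card_univ]

theorem markLaw_noEdge_univ (lam : ℝ≥0) (v : Vertex) :
    markLaw lam (noEdge v Set.univ) = ENNReal.ofReal (Real.exp (-(lam / 2))) := by
  have h := markLaw_noEdge lam {v} (fun _ => Set.univ) (fun _ => MeasurableSet.univ)
  simpa using h

/-! ### First moment over all splits -/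

/-- The vertices of length `n`. -/
noncomputable def level (n : ℕ) : Finset Vertex :=
  (Finset.univ : Finset (Fin n → Bool)).map ⟨List.ofFn, List.ofFn_injective⟩

theorem mem_level {n : ℕ} {v : Vertex} : v ∈ level n ↔ v.length = n := by
  simp only [level, Finset.mem_map, Finset.mem_univ, true_and, Function.Embedding.coeFn_mk]
  constructor
  · rintro ⟨f, rfl⟩
    exact List.length_ofFn
  · rintro rfl
    exact ⟨v.get, List.ofFn_get v⟩

theorem card_level (n : ℕ) : (level n).card = 2 ^ n := by
  simp [level]

/-- The expected number of vertices of length `n` that have split by time `t`. -/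
theorem sum_level_clockLaw_le (n : ℕ) (t : ℝ) {θ : ℝ} (hθ : 0 ≤ θ) :
    ∑ v ∈ level n, clockLaw {c | clockSplit c v ≤ t} ≤
      ENNReal.ofReal (Real.exp (θ * t) * (2 / (1 + θ)) ^ n) := by
  have h : ∀ v ∈ level n, clockLaw {c | clockSplit c v ≤ t} ≤
      ENNReal.ofReal (Real.exp (θ * t) * (1 / (1 + θ)) ^ n) := by
    intro v hv
    refine (clockLaw_clockSplit_le v t hθ).trans (ENNReal.ofReal_le_ofReal ?_)
    rw [mem_level.1 hv]
    gcongr ?_ * ?_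
    -- One of the `n + 1` factors, each at most 1, is given away.
    refine pow_le_pow_of_le_one (by positivity) ?_ (Nat.le_succ n)
    rw [div_le_one (by positivity)]
    linarith
  refine (Finset.sum_le_sum h).trans (le_of_eq ?_)
  rw [Finset.sum_const, card_level, nsmul_eq_mul, Nat.cast_pow, Nat.cast_ofNat,
    show (2 : ℝ≥0∞) = ENNReal.ofReal 2 by simp, ← ENNReal.ofReal_pow (by norm_num),
    ← ENNReal.ofReal_mul (by positivity)]
  congr 1
  rw [div_pow, div_pow]
  ring

/-- The process does not explode. -/
theorem clockLaw_explosion_eq_zero (t : ℝ) :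
    clockLaw {c | ∀ n : ℕ, ∃ v : Vertex, v.length = n ∧ clockSplit c v ≤ t} = 0 := by
  have h : ∀ n : ℕ, clockLaw {c | ∀ n : ℕ, ∃ v : Vertex, v.length = n ∧ clockSplit c v ≤ t} ≤
      ENNReal.ofReal (Real.exp (2 * t) * (2 / 3) ^ n) := by
    intro n
    -- Any `θ > 1` gives a ratio below 1 between generations; here it is 2/3.
    have h2 := sum_level_clockLaw_le n t (θ := 2) (by norm_num)
    norm_num at h2
    refine le_trans ?_ h2
    refine le_trans (measure_mono ?_) (measure_biUnion_finset_le _ _)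
    intro c hc
    obtain ⟨v, hv, hs⟩ := hc n
    exact Set.mem_biUnion (mem_level.2 hv) hs
  have hlim : Tendsto (fun n : ℕ => ENNReal.ofReal (Real.exp (2 * t) * (2 / 3) ^ n)) atTop
      (𝓝 (ENNReal.ofReal (Real.exp (2 * t) * 0))) :=
    ENNReal.tendsto_ofReal
      ((tendsto_pow_atTop_nhds_zero_of_lt_one (by norm_num) (by norm_num)).const_mul _)
  rw [mul_zero, ENNReal.ofReal_zero] at hlim
  exact le_antisymm (ge_of_tendsto' hlim h) zero_le

/-- The first-moment bound for the failure of connectedness. -/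
theorem law_not_isConnected_le (lam : ℝ≥0) {t : ℝ} (ht : 0 ≤ t) (K : ℕ) {δ : ℝ} (hδ : 0 < δ) :
    law lam {ω | ¬ IsConnected (graphAt ω t)} ≤
      ENNReal.ofReal (2 ^ K * Real.exp (-(lam / 2))) +
      ENNReal.ofReal (Fintype.card (Fin K → Failure K) * ((2 + δ) / δ) *
        Real.exp ((1 + δ) * t - lam * (1 - (1 / 2) ^ (K + 1)))) := by
  set A : Set (Vertex → ℝ) := {c | ¬ ∀ v, 0 < c v} with hA
  set B : Set (Vertex → ℝ) := {c | ∀ n : ℕ, ∃ v : Vertex, v.length = n ∧ clockSplit c v ≤ t} with hB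
  set C : Vertex → Set (Vertex → ℝ) := fun v => {c | clockSplit c v ≤ t} with hC
  -- Null sets aside, either some vertex of a generation below `K`, which has too few ancestors for
  -- `badMarks`, has no new edges, or some later vertex splits by time `t` with bad marks.
  have hsub : {ω : Sample | ¬ IsConnected (graphAt ω t)} ⊆
      ((A ×ˢ Set.univ) ∪ (B ×ˢ Set.univ)) ∪
      ((⋃ n ∈ Finset.range K, ⋃ v ∈ level n, (Set.univ : Set (Vertex → ℝ)) ×ˢ noEdge v Set.univ) ∪
      (⋃ n : {n : ℕ // K ≤ n}, ⋃ v ∈ level n, C v ×ˢ badMarks K v)) := by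
    intro ω hω
    by_contra hn
    simp only [Set.mem_union, Set.mem_prod, Set.mem_univ, and_true, true_and, Set.mem_iUnion,
      not_or, not_exists, not_and, Finset.mem_range, mem_level] at hn
    obtain ⟨⟨h1, h2⟩, h3, h4⟩ := hn
    have hpos : ∀ v, 0 < ω.1 v := by
      by_contra h
      exact h1 h
    have h2' : ¬ ∀ n : ℕ, ∃ v : Vertex, v.length = n ∧ clockSplit ω.1 v ≤ t := h2
    push Not at h2'
    obtain ⟨n, hn⟩ := h2'
    refine hω (isConnected_of_siblings hpos ht (n := n + 1) ?_ ?_)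
    · intro v hv
      cases v with
      | nil => simp at hv
      | cons b v =>
        have := hn v (by simpa using hv)
        rwa [← splitTime_eq] at this
    · intro v hs
      by_cases hK : v.length < K
      · exact truncReach_siblings_of_newEdges hs (notMem_noEdge_univ.1 (h3 _ hK v rfl))
      · push Not at hK
        refine truncReach_siblings_of_notMem_badMarks hpos hK hs (h4 ⟨_, hK⟩ v rfl ?_)
        rw [splitTime_eq] at hs
        exact hs
  have hA0 : clockLaw A = 0 := ae_iff.1 ae_clock_pos
  have hB0 : clockLaw B = 0 := clockLaw_explosion_eq_zero t
  refine (measure_mono hsub).trans ((measure_union_le _ _).trans ?_)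
  have h12 : law lam ((A ×ˢ Set.univ) ∪ (B ×ˢ Set.univ)) = 0 := by
    refine measure_union_null ?_ ?_ <;> rw [law_eq, Measure.prod_prod]
    · rw [hA0, zero_mul]
    · rw [hB0, zero_mul]
  rw [h12, zero_add]
  refine (measure_union_le _ _).trans (add_le_add ?_ ?_)
  · refine (measure_biUnion_finset_le _ _).trans ?_
    have h : ∀ n ∈ Finset.range K, law lam (⋃ v ∈ level n,
        (Set.univ : Set (Vertex → ℝ)) ×ˢ noEdge v Set.univ) ≤
        ENNReal.ofReal (2 ^ n * Real.exp (-(lam / 2))) := by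
      intro n _
      refine (measure_biUnion_finset_le _ _).trans (le_of_eq ?_)
      simp only [law_eq, Measure.prod_prod, measure_univ, one_mul, markLaw_noEdge_univ,
        Finset.sum_const, card_level, nsmul_eq_mul]
      rw [Nat.cast_pow, Nat.cast_ofNat, show (2 : ℝ≥0∞) = ENNReal.ofReal 2 by simp,
        ← ENNReal.ofReal_pow (by norm_num), ← ENNReal.ofReal_mul (by positivity)]
    refine (Finset.sum_le_sum h).trans ?_
    rw [← ENNReal.ofReal_sum_of_nonneg (fun n _ => by positivity), ← Finset.sum_mul]
    refine ENNReal.ofReal_le_ofReal ?_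
    gcongr
    rw [geom_sum_eq (by norm_num)]
    norm_num
  · refine (measure_iUnion_le _).trans ?_
    set m : ℝ≥0∞ := Fintype.card (Fin K → Failure K) *
      ENNReal.ofReal (Real.exp (-(lam * (1 - (1 / 2) ^ (K + 1))))) with hm
    have hr0 : 0 ≤ 2 / (2 + δ) := by positivity
    have hr1 : 2 / (2 + δ) < 1 := by
      rw [div_lt_one (by positivity)]; linarith
    have h : ∀ n : {n : ℕ // K ≤ n}, law lam (⋃ v ∈ level n, C v ×ˢ badMarks K v) ≤
        ENNReal.ofReal (Real.exp ((1 + δ) * t) * (2 / (2 + δ)) ^ (n : ℕ)) * m := by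
      intro n
      refine (measure_biUnion_finset_le _ _).trans ?_
      calc ∑ v ∈ level n, law lam (C v ×ˢ badMarks K v)
          ≤ ∑ v ∈ level n, clockLaw (C v) * m := by
            refine Finset.sum_le_sum fun v hv => ?_
            rw [law_eq, Measure.prod_prod]
            exact mul_le_mul_right (markLaw_badMarks_le lam (by rw [mem_level.1 hv]; exact n.2)) _
        _ = (∑ v ∈ level n, clockLaw (C v)) * m := by rw [Finset.sum_mul]
        _ ≤ _ := by
            -- The growth rate 1 is exceeded by `δ` to make the sum over generations a convergent
            -- geometric series.
            have := sum_level_clockLaw_le n t (θ := 1 + δ) (by positivity)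
            rw [show 1 + (1 + δ) = 2 + δ by ring] at this
            exact mul_le_mul_left this _
    refine (ENNReal.tsum_le_tsum h).trans ?_
    rw [ENNReal.tsum_mul_right]
    have hs : ∑' n : {n : ℕ // K ≤ n},
        ENNReal.ofReal (Real.exp ((1 + δ) * t) * (2 / (2 + δ)) ^ (n : ℕ)) ≤
        ENNReal.ofReal (Real.exp ((1 + δ) * t) * ((2 + δ) / δ)) := by
      refine (ENNReal.tsum_comp_le_tsum_of_injective Subtype.val_injective
        (fun n : ℕ => ENNReal.ofReal (Real.exp ((1 + δ) * t) * (2 / (2 + δ)) ^ n))).trans ?_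
      rw [← ENNReal.ofReal_tsum_of_nonneg (fun n => by positivity)
        ((summable_geometric_of_lt_one hr0 hr1).mul_left _), tsum_mul_left,
        tsum_geometric_of_lt_one hr0 hr1]
      refine le_of_eq ?_
      rw [show 1 - 2 / (2 + δ) = δ / (2 + δ) by field_simp; ring, inv_div]
    refine (mul_le_mul_left hs _).trans (le_of_eq ?_)
    rw [hm, ← ENNReal.ofReal_natCast, ← ENNReal.ofReal_mul (by positivity),
      ← ENNReal.ofReal_mul (by positivity)]
    congr 1
    rw [Real.exp_sub, Real.exp_neg]
    ring

/-! ### Stray vertices and their correlations -/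

/-- The choices that lead an end of an edge added at the split of `u` to the vertex `x`. -/
def routeTo (x u : Vertex) : Set (Vertex → Bool) :=
  {χ | ∃ b l, x = l ++ b :: u ∧ Follow χ (b :: u) l}

/-- No edge is led to `x`. -/
def strayMarks (x : Vertex) : Set Marks := {η | ∀ u, η ∈ noEdge u (routeTo x u)}

theorem routeTo_append (l : Vertex) (b : Bool) (u : Vertex) :
    routeTo (l ++ b :: u) u = {χ | Follow χ (b :: u) l} := by
  ext χ
  constructor
  · rintro ⟨b', l', h, hf⟩
    obtain ⟨h1, h2⟩ := List.append_inj' h (by simp)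
    rw [h1]
    rw [List.cons.injEq] at h2
    rw [h2.1]
    exact hf
  · exact fun h => ⟨b, l, rfl, h⟩

theorem routeTo_eq_empty {x u : Vertex} (h : ¬ ∃ l b, x = l ++ b :: u) : routeTo x u = ∅ := by
  ext χ
  simp only [routeTo, Set.mem_ofPred_eq, Set.mem_empty_iff_false, iff_false]
  rintro ⟨b, l, h', -⟩
  exact h ⟨l, b, h'⟩

theorem measurableSet_routeTo (x u : Vertex) : MeasurableSet (routeTo x u) := by
  by_cases h : ∃ l b, x = l ++ b :: u
  · obtain ⟨l, b, rfl⟩ := h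
    rw [routeTo_append]
    exact measurableSet_follow _ _
  · rw [routeTo_eq_empty h]
    exact MeasurableSet.empty

theorem choiceLaw_routeTo_append (l : Vertex) (b : Bool) (u : Vertex) :
    choiceLaw.real (routeTo (l ++ b :: u) u) = (1 / 2 : ℝ) ^ l.length := by
  rw [routeTo_append, choiceLaw_follow]

/-- The strict ancestors of a vertex. -/
def ancestors (x : Vertex) : Finset Vertex :=
  (Finset.range x.length).image fun j => x.drop (j + 1)

theorem mem_ancestors {x u : Vertex} : u ∈ ancestors x ↔ ∃ l b, x = l ++ b :: u := by
  simp only [ancestors, Finset.mem_image, Finset.mem_range]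
  constructor
  · rintro ⟨j, hj, rfl⟩
    exact ⟨x.take j, x.getD j false, by rw [← drop_eq_getD_cons hj, List.take_append_drop]⟩
  · rintro ⟨l, b, rfl⟩
    exact ⟨l.length, by simp, by simp⟩

theorem sum_choiceLaw_routeTo_le (x : Vertex) {U : Finset Vertex} (hU : ancestors x ⊆ U) :
    ∑ u ∈ U, choiceLaw.real (routeTo x u) ≤ 2 := by
  have h0 : ∑ u ∈ U, choiceLaw.real (routeTo x u) =
      ∑ u ∈ ancestors x, choiceLaw.real (routeTo x u) := by
    refine (Finset.sum_subset hU fun u _ hu => ?_).symm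
    rw [routeTo_eq_empty (fun h => hu (mem_ancestors.2 h)), measureReal_empty]
  have hinj : Set.InjOn (fun j => x.drop (j + 1)) (Finset.range x.length : Set ℕ) := by
    intro i hi j hj h
    have := congrArg List.length h
    simp only [Finset.coe_range, Set.mem_Iio] at hi hj
    simp only [List.length_drop] at this
    omega
  rw [h0, ancestors, Finset.sum_image hinj]
  have h1 : ∀ j ∈ Finset.range x.length,
      choiceLaw.real (routeTo x (x.drop (j + 1))) = (1 / 2 : ℝ) ^ j := by
    intro j hj
    have hj' := Finset.mem_range.1 hj
    have hx : x = x.take j ++ x.getD j false :: x.drop (j + 1) := by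
      rw [← drop_eq_getD_cons hj', List.take_append_drop]
    have := choiceLaw_routeTo_append (x.take j) (x.getD j false) (x.drop (j + 1))
    rw [← hx, List.length_take, min_eq_left hj'.le] at this
    exact this
  rw [Finset.sum_congr rfl h1, geom_sum_eq (by norm_num)]
  have : (0 : ℝ) ≤ (1 / 2) ^ x.length := by positivity
  rw [show ((1 / 2 : ℝ) ^ x.length - 1) / (1 / 2 - 1) = 2 - 2 * (1 / 2) ^ x.length by ring]
  linarith

theorem mem_strayMarks_iff {x : Vertex} {U : Finset Vertex} (hU : ancestors x ⊆ U) {η : Marks} :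
    η ∈ strayMarks x ↔ ∀ u ∈ U, η ∈ noEdge u (routeTo x u) := by
  refine ⟨fun h u _ => h u, fun h u => ?_⟩
  by_cases hu : u ∈ ancestors x
  · exact h u (hU hu)
  · rw [routeTo_eq_empty (fun h => hu (mem_ancestors.2 h))]
    intro k _
    exact Set.notMem_empty _

theorem measurableSet_strayMarks (x : Vertex) : MeasurableSet (strayMarks x) := by
  have : strayMarks x = ⋂ u, noEdge u (routeTo x u) := by
    ext; simp [strayMarks]
  rw [this]
  exact MeasurableSet.iInter fun u => measurableSet_noEdge u (measurableSet_routeTo x u)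

theorem markLaw_strayMarks (lam : ℝ≥0) (x : Vertex) {U : Finset Vertex} (hU : ancestors x ⊆ U) :
    (markLaw lam).real (strayMarks x) =
      Real.exp (-(lam / 2 * ∑ u ∈ U, choiceLaw.real (routeTo x u))) := by
  have h : strayMarks x = {η | ∀ u ∈ U, η ∈ noEdge u (routeTo x u)} := by
    ext η
    exact mem_strayMarks_iff hU
  rw [h, measureReal_def, markLaw_noEdge _ _ _ (measurableSet_routeTo x),
    ENNReal.toReal_ofReal (Real.exp_pos _).le]

/-- Inclusion–exclusion in the exponent of the thinning formula: the correlation comes only from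
edges that could reach both vertices. -/
theorem markLaw_strayMarks_inter (lam : ℝ≥0) (x y : Vertex) {U : Finset Vertex}
    (hx : ancestors x ⊆ U) (hy : ancestors y ⊆ U) :
    (markLaw lam).real (strayMarks x ∩ strayMarks y) =
      (markLaw lam).real (strayMarks x) * (markLaw lam).real (strayMarks y) *
      Real.exp (lam / 2 * ∑ u ∈ U, choiceLaw.real (routeTo x u ∩ routeTo y u)) := by
  have h : strayMarks x ∩ strayMarks y =
      {η | ∀ u ∈ U, η ∈ noEdge u (routeTo x u ∪ routeTo y u)} := by
    ext η
    rw [Set.mem_inter_iff, mem_strayMarks_iff hx, mem_strayMarks_iff hy, ← forall₂_and]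
    refine forall₂_congr fun u _ => ?_
    simp only [noEdge, Set.mem_ofPred_eq, Set.mem_union, not_or, ← forall₂_and]
  rw [h, measureReal_def, markLaw_noEdge _ _ _
    (fun u => (measurableSet_routeTo x u).union (measurableSet_routeTo y u)),
    ENNReal.toReal_ofReal (Real.exp_pos _).le, markLaw_strayMarks lam x hx,
    markLaw_strayMarks lam y hy, ← Real.exp_add, ← Real.exp_add]
  have hsum : ∑ u ∈ U, choiceLaw.real (routeTo x u ∪ routeTo y u) =
      ∑ u ∈ U, choiceLaw.real (routeTo x u) + ∑ u ∈ U, choiceLaw.real (routeTo y u) -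
      ∑ u ∈ U, choiceLaw.real (routeTo x u ∩ routeTo y u) := by
    rw [← Finset.sum_add_distrib, ← Finset.sum_sub_distrib]
    refine Finset.sum_congr rfl fun u _ => ?_
    have := measureReal_union_add_inter (μ := choiceLaw) (s := routeTo x u)
      (measurableSet_routeTo y u)
    linarith
  rw [hsum]
  congr 1; ring

theorem exp_neg_le_markLaw_strayMarks (lam : ℝ≥0) (x : Vertex) :
    Real.exp (-lam) ≤ (markLaw lam).real (strayMarks x) := by
  rw [markLaw_strayMarks lam x subset_rfl]
  refine Real.exp_le_exp.2 (neg_le_neg ?_)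
  have h := sum_choiceLaw_routeTo_le x subset_rfl
  have hl : (0 : ℝ) ≤ lam / 2 := by positivity
  calc (lam : ℝ) / 2 * ∑ u ∈ ancestors x, choiceLaw.real (routeTo x u) ≤ lam / 2 * 2 := by gcongr
    _ = lam := by ring

/-- Each vertex has one heir under `χ`, so the routes from `a` form a chain. -/
theorem Follow.suffix_or_suffix {χ : Vertex → Bool} {a : Vertex} : ∀ {l l' : Vertex},
    Follow χ a l → Follow χ a l' → l <:+ l' ∨ l' <:+ l
  | [], _, _, _ => Or.inl (List.nil_suffix)
  | _, [], _, _ => Or.inr (List.nil_suffix)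
  | c :: l, c' :: l', h, h' => by
    rcases lt_trichotomy l.length l'.length with hlt | heq | hlt
    · rcases Follow.suffix_or_suffix h h'.1 with h1 | h1
      · exact Or.inl (h1.trans (List.suffix_cons _ _))
      · have h2 := h1.length_le
        rw [List.length_cons] at h2
        have h3 := h1.eq_of_length (by rw [List.length_cons]; omega)
        rw [h3]
        exact Or.inl (List.suffix_cons _ _)
    · have hl : l = l' := by
        rcases Follow.suffix_or_suffix h.1 h'.1 with h1 | h1
        · exact h1.eq_of_length heq
        · exact (h1.eq_of_length heq.symm).symm
      subst hl
      rw [← h.2, ← h'.2]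
      exact Or.inl List.suffix_rfl
    · rcases Follow.suffix_or_suffix h.1 h' with h1 | h1
      · have h2 := h1.length_le
        rw [List.length_cons] at h2
        have h3 := h1.eq_of_length (by rw [List.length_cons]; omega)
        rw [h3]
        exact Or.inr (List.suffix_cons _ _)
      · exact Or.inr (h1.trans (List.suffix_cons _ _))

/-- Two vertices of which none is a descendant of the other. -/
def Incomparable (x y : Vertex) : Prop := ¬ x <:+ y ∧ ¬ y <:+ x

/-- Such a `u` must be the last common ancestor: the two ends of the edge start at different
offspring of `u`, so every common ancestor of `x` and `y` is `u` or an ancestor of `u`. -/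
theorem Incomparable.eq_of_nonempty {x y : Vertex} (h : Incomparable x y) {u u' : Vertex}
    (hu : (routeTo x u ∩ routeTo y u).Nonempty) (hu' : (routeTo x u' ∩ routeTo y u').Nonempty) :
    u = u' := by
  have key : ∀ {u}, (routeTo x u ∩ routeTo y u).Nonempty → ∀ {a}, a <:+ x → a <:+ y → a <:+ u := by
    rintro u ⟨χ, ⟨b, l, hx, hl⟩, ⟨b', l', hy, hl'⟩⟩ a hax hay
    -- Were both routes to start at the same offspring, one would extend the other and make `x` and
    -- `y` comparable.
    have hbb : b ≠ b' := by
      rintro rfl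
      rcases hl.suffix_or_suffix hl' with ⟨m, hm⟩ | ⟨m, hm⟩
      · exact h.1 ⟨m, by rw [hx, hy, ← hm, List.append_assoc]⟩
      · exact h.2 ⟨m, by rw [hx, hy, ← hm, List.append_assoc]⟩
    by_contra hau
    have hlen : u.length < a.length := by
      by_contra hle
      push Not at hle
      exact hau (List.suffix_of_suffix_length_le hax ⟨l ++ [b], by simp [hx]⟩ hle)
    have h1 : (b :: u) <:+ a := List.suffix_of_suffix_length_le ⟨l, hx.symm⟩ hax (by simpa using hlen)
    have h2 : (b' :: u) <:+ a := List.suffix_of_suffix_length_le ⟨l', hy.symm⟩ hay (by simpa using hlen)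
    have h3 := (List.suffix_of_suffix_length_le h1 h2 (by simp)).eq_of_length (by simp)
    exact hbb (List.cons.inj h3).1
  have hsub : ∀ {u}, (routeTo x u ∩ routeTo y u).Nonempty → u <:+ x ∧ u <:+ y := by
    rintro u ⟨χ, ⟨b, l, hx, -⟩, ⟨b', l', hy, -⟩⟩
    exact ⟨⟨l ++ [b], by simp [hx]⟩, ⟨l' ++ [b'], by simp [hy]⟩⟩
  have h1 := key hu' (hsub hu).1 (hsub hu).2
  have h2 := key hu (hsub hu').1 (hsub hu').2
  exact h1.eq_of_length (le_antisymm h1.length_le h2.length_le)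

theorem Incomparable.sum_inter_le {x y : Vertex} (h : Incomparable x y) (U : Finset Vertex) {β : ℝ}
    (hβ : 0 ≤ β) (hle : ∀ u, choiceLaw.real (routeTo x u ∩ routeTo y u) ≤ β) :
    ∑ u ∈ U, choiceLaw.real (routeTo x u ∩ routeTo y u) ≤ β := by
  by_cases hne : ∃ u0, (routeTo x u0 ∩ routeTo y u0).Nonempty
  · obtain ⟨u0, h0⟩ := hne
    have hz : ∀ u, u ≠ u0 → choiceLaw.real (routeTo x u ∩ routeTo y u) = 0 := by
      intro u hu
      rw [Set.not_nonempty_iff_eq_empty.1 fun h' => hu (h.eq_of_nonempty h' h0), measureReal_empty]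
    by_cases hU : u0 ∈ U
    · rw [Finset.sum_eq_single u0 (fun u _ hu => hz u hu) (fun h => absurd hU h)]
      exact hle u0
    · rw [Finset.sum_eq_zero fun u hu => hz u (fun h => hU (h ▸ hu))]
      exact hβ
  · push Not at hne
    rw [Finset.sum_eq_zero fun u _ => by rw [hne u, measureReal_empty]]
    exact hβ

/-- The vertices whose last common ancestor with `x` is at distance at most `R + 1` from both. -/
noncomputable def closeSet (R : ℕ) (x : Vertex) : Finset Vertex :=
  (Finset.range (R + 1)).biUnion fun j =>
    ((Finset.range (R + 2)).biUnion fun i => level i).image fun l => l ++ x.drop (j + 1)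

theorem card_closeSet_le (R : ℕ) (x : Vertex) : (closeSet R x).card ≤ 4 ^ (R + 1) := by
  have h1 : ((Finset.range (R + 2)).biUnion fun i => level i).card ≤ 2 ^ (R + 2) := by
    refine Finset.card_biUnion_le.trans ?_
    simp only [card_level]
    exact (Nat.geomSum_lt (n := R + 2) le_rfl fun k hk => Finset.mem_range.1 hk).le
  calc (closeSet R x).card ≤ ∑ j ∈ Finset.range (R + 1), 2 ^ (R + 2) :=
        Finset.card_biUnion_le.trans (Finset.sum_le_sum fun j _ => Finset.card_image_le.trans h1)
    _ = (R + 1) * 2 ^ (R + 2) := by simp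
    _ ≤ 2 ^ R * 2 ^ (R + 2) := Nat.mul_le_mul_right _ Nat.lt_two_pow_self
    _ = 4 ^ (R + 1) := by
      rw [← pow_add, show (4 : ℕ) = 2 ^ 2 by norm_num, ← pow_mul]
      congr 1; ring

/-- Outside `closeSet`, at least one of the two routes from a common ancestor makes `R` or more
choices, and its probability alone is small enough. -/
theorem choiceLaw_inter_le_of_notMem_closeSet {R : ℕ} {x y : Vertex} (h : y ∉ closeSet R x)
    (u : Vertex) : choiceLaw.real (routeTo x u ∩ routeTo y u) ≤ (1 / 2) ^ R := by
  by_cases hx : ∃ l b, x = l ++ b :: u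
  swap
  · rw [routeTo_eq_empty hx, Set.empty_inter, measureReal_empty]; positivity
  by_cases hy : ∃ l b, y = l ++ b :: u
  swap
  · rw [routeTo_eq_empty hy, Set.inter_empty, measureReal_empty]; positivity
  obtain ⟨l, b, rfl⟩ := hx
  obtain ⟨l', b', rfl⟩ := hy
  by_cases hl : l.length ≤ R
  · have hl' : R ≤ l'.length := by
      by_contra hlt
      refine h (Finset.mem_biUnion.2 ⟨l.length, by simpa using Nat.lt_succ_of_le hl, ?_⟩)
      refine Finset.mem_image.2 ⟨l' ++ [b'], Finset.mem_biUnion.2 ⟨l'.length + 1, ?_, ?_⟩, ?_⟩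
      · simp; omega
      · simp [mem_level]
      · simp
    calc _ ≤ choiceLaw.real (routeTo (l' ++ b' :: u) u) :=
          measureReal_mono Set.inter_subset_right
      _ = (1 / 2) ^ l'.length := choiceLaw_routeTo_append _ _ _
      _ ≤ _ := pow_le_pow_of_le_one (by norm_num) (by norm_num) hl'
  · calc _ ≤ choiceLaw.real (routeTo (l ++ b :: u) u) :=
          measureReal_mono Set.inter_subset_left
      _ = (1 / 2) ^ l.length := choiceLaw_routeTo_append _ _ _
      _ ≤ _ := pow_le_pow_of_le_one (by norm_num) (by norm_num) (not_le.1 hl).le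

/-! ### Second moment -/

/-- The second-moment bound for the probability that none of finitely many events occurs. -/
theorem measureReal_forall_notMem_le {α Ω : Type*} [MeasurableSpace Ω] (P : Measure Ω)
    [IsProbabilityMeasure P] (F : Finset α) (I : α → Set Ω) (hI : ∀ x, MeasurableSet (I x))
    (hp : ∀ x, 0 < P.real (I x)) (hF : F.Nonempty) :
    P.real {η | ∀ x ∈ F, η ∉ I x} ≤
      (∑ x ∈ F, ∑ y ∈ F, P.real (I x ∩ I y) / (P.real (I x) * P.real (I y))) / (F.card : ℝ) ^ 2 -
        1 := by
  set M : ℝ := (F.card : ℝ) with hM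
  have hM0 : 0 < M := by simpa [hM] using hF
  -- Dividing by the probabilities gives every term mean 1, so that unequal probabilities do no
  -- harm.
  set g : α → Ω → ℝ := fun x => (I x).indicator fun _ => (P.real (I x))⁻¹ with hg
  have hgi : ∀ x, Integrable (g x) P := fun x => (integrable_const _).indicator (hI x)
  have hmul : ∀ x y, (fun η => g x η * g y η) =
      (I x ∩ I y).indicator fun _ => (P.real (I x))⁻¹ * (P.real (I y))⁻¹ := by
    intro x y
    ext η
    by_cases h1 : η ∈ I x <;> by_cases h2 : η ∈ I y <;> simp [hg, h1, h2]
  have hmi : ∀ x y, Integrable (fun η => g x η * g y η) P := fun x y => by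
    rw [hmul]; exact (integrable_const _).indicator ((hI x).inter (hI y))
  have h1 : ∀ x, ∫ η, g x η ∂P = 1 := by
    intro x
    simp only [hg]
    rw [integral_indicator_const _ (hI x), smul_eq_mul, mul_inv_cancel₀ (hp x).ne']
  have h2 : ∀ x y, ∫ η, g x η * g y η ∂P = P.real (I x ∩ I y) / (P.real (I x) * P.real (I y)) := by
    intro x y
    rw [hmul, integral_indicator_const _ ((hI x).inter (hI y)), smul_eq_mul, div_eq_mul_inv,
      mul_inv]
  set f : Ω → ℝ := fun η => ∑ x ∈ F, g x η with hf
  have hfi : Integrable f P := integrable_finsetSum _ fun x _ => hgi x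
  have hsq : (fun η => f η ^ 2) = fun η => ∑ x ∈ F, ∑ y ∈ F, g x η * g y η := by
    ext η
    rw [hf, sq, Finset.sum_mul_sum]
  have hfsi : Integrable (fun η => f η ^ 2) P := by
    rw [hsq]
    exact integrable_finsetSum _ fun x _ => integrable_finsetSum _ fun y _ => hmi x y
  have hf1 : ∫ η, f η ∂P = M := by
    rw [hf, integral_finsetSum _ fun x _ => hgi x]
    simp [h1, hM]
  have hf2 : ∫ η, f η ^ 2 ∂P =
      ∑ x ∈ F, ∑ y ∈ F, P.real (I x ∩ I y) / (P.real (I x) * P.real (I y)) := by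
    rw [hsq, integral_finsetSum _ fun x _ => integrable_finsetSum _ fun y _ => hmi x y]
    refine Finset.sum_congr rfl fun x _ => ?_
    rw [integral_finsetSum _ fun y _ => hmi x y]
    exact Finset.sum_congr rfl fun y _ => h2 x y
  have hdi : Integrable (fun η => f η ^ 2 - 2 * M * f η) P := hfsi.sub (hfi.const_mul _)
  have hvi : Integrable (fun η => f η ^ 2 - 2 * M * f η + M ^ 2) P := hdi.add (integrable_const _)
  have hvar : ∫ η, (f η ^ 2 - 2 * M * f η + M ^ 2) ∂P = ∫ η, f η ^ 2 ∂P - M ^ 2 := by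
    rw [integral_add hdi (integrable_const _),
      integral_sub hfsi (hfi.const_mul _), integral_const_mul, hf1]
    simp
    ring
  -- Chebyshev's inequality: if no event occurs, then f = 0 and (f - M)^2 = M^2.
  have hmarkov := mul_meas_ge_le_integral_of_nonneg
    (Eventually.of_forall fun η => by
      have : f η ^ 2 - 2 * M * f η + M ^ 2 = (f η - M) ^ 2 := by ring
      simp only [Pi.zero_apply, this]
      positivity) hvi (M ^ 2)
  rw [hvar, hf2] at hmarkov
  have hle : P.real {η | ∀ x ∈ F, η ∉ I x} ≤
      P.real {η | M ^ 2 ≤ f η ^ 2 - 2 * M * f η + M ^ 2} := by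
    refine measureReal_mono fun η hη => ?_
    have : f η = 0 := Finset.sum_eq_zero fun x hx => Set.indicator_of_notMem (hη x hx) _
    simp [this]
  rw [le_sub_iff_add_le, le_div_iff₀ (by positivity)]
  nlinarith [mul_le_mul_of_nonneg_left hle (sq_nonneg M)]

/-- The probability that edges are led to all of many incomparable vertices. -/
theorem markLaw_forall_notMem_strayMarks_le (lam : ℝ≥0) (R : ℕ) {F : Finset Vertex}
    (hF : F.Nonempty) (hinc : ∀ x ∈ F, ∀ y ∈ F, x ≠ y → Incomparable x y) :
    (markLaw lam).real {η | ∀ x ∈ F, η ∉ strayMarks x} ≤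
      (Real.exp (lam * (1 / 2) ^ R) - 1) +
        (4 ^ (R + 1) * Real.exp (lam / 2) + Real.exp lam) / F.card := by
  set p : Vertex → ℝ := fun x => (markLaw lam).real (strayMarks x) with hp
  have hp0 : ∀ x, 0 < p x := fun x => (Real.exp_pos _).trans_le (exp_neg_le_markLaw_strayMarks lam x)
  have hM0 : 0 < (F.card : ℝ) := by simpa using hF
  have hl : (0 : ℝ) ≤ lam / 2 := by positivity
  -- The three terms account for distant pairs, for close pairs with at most one common origin of
  -- weight 1, and for the diagonal, where 1/p(x) ≤ e^λ.
  have hpair : ∀ x ∈ F, ∀ y ∈ F,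
      (markLaw lam).real (strayMarks x ∩ strayMarks y) / (p x * p y) ≤
      Real.exp (lam * (1 / 2) ^ R) + (if y ∈ closeSet R x then Real.exp (lam / 2) else 0) +
        if x = y then Real.exp lam else 0 := by
    intro x hx y hy
    by_cases hxy : x = y
    · subst hxy
      rw [Set.inter_self, if_pos rfl]
      have h1 : (markLaw lam).real (strayMarks x) / (p x * p x) = (p x)⁻¹ := by
        have := (hp0 x).ne'
        simp only [hp] at this ⊢
        field_simp
      have h2 : (p x)⁻¹ ≤ Real.exp lam := by
        rw [inv_le_comm₀ (hp0 x) (Real.exp_pos _), ← Real.exp_neg]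
        exact exp_neg_le_markLaw_strayMarks lam x
      rw [h1]
      have h3 : 0 ≤ if x ∈ closeSet R x then Real.exp (lam / 2) else 0 := by split_ifs <;> positivity
      have h4 := Real.exp_pos (lam * (1 / 2) ^ R)
      linarith
    · have h := hinc x hx y hy hxy
      have heq : (markLaw lam).real (strayMarks x ∩ strayMarks y) / (p x * p y) =
          Real.exp (lam / 2 * ∑ u ∈ ancestors x ∪ ancestors y,
            choiceLaw.real (routeTo x u ∩ routeTo y u)) := by
        rw [markLaw_strayMarks_inter lam x y Finset.subset_union_left Finset.subset_union_right]
        exact mul_div_cancel_left₀ _ (mul_pos (hp0 x) (hp0 y)).ne'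
      rw [heq, if_neg hxy, add_zero]
      by_cases hc : y ∈ closeSet R x
      · rw [if_pos hc]
        have h1 := h.sum_inter_le (ancestors x ∪ ancestors y) zero_le_one
          fun u => measureReal_le_one
        have h2 : Real.exp (lam / 2 * ∑ u ∈ ancestors x ∪ ancestors y,
            choiceLaw.real (routeTo x u ∩ routeTo y u)) ≤ Real.exp (lam / 2) :=
          Real.exp_le_exp.2 (mul_le_of_le_one_right hl h1)
        have h4 := Real.exp_pos (lam * (1 / 2) ^ R)
        linarith
      · rw [if_neg hc, add_zero]
        have h1 := h.sum_inter_le (ancestors x ∪ ancestors y) (by positivity)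
          (choiceLaw_inter_le_of_notMem_closeSet hc)
        refine Real.exp_le_exp.2 ((mul_le_mul_of_nonneg_left h1 hl).trans ?_)
        have : (0 : ℝ) ≤ (1 / 2) ^ R := by positivity
        have hl' : (0 : ℝ) ≤ lam := lam.2
        nlinarith
  have hrow : ∀ x ∈ F, ∑ y ∈ F, (markLaw lam).real (strayMarks x ∩ strayMarks y) / (p x * p y) ≤
      F.card * Real.exp (lam * (1 / 2) ^ R) +
        (4 ^ (R + 1) * Real.exp (lam / 2) + Real.exp lam) := by
    intro x hx
    refine (Finset.sum_le_sum fun y hy => hpair x hx y hy).trans ?_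
    rw [Finset.sum_add_distrib, Finset.sum_add_distrib, Finset.sum_const, nsmul_eq_mul,
      Finset.sum_ite_eq, if_pos hx, ← Finset.sum_filter, Finset.sum_const, nsmul_eq_mul, add_assoc]
    gcongr
    have h1 : (F.filter fun y => y ∈ closeSet R x).card ≤ 4 ^ (R + 1) :=
      (Finset.card_le_card fun y hy => (Finset.mem_filter.1 hy).2).trans (card_closeSet_le R x)
    exact_mod_cast h1
  refine (measureReal_forall_notMem_le (markLaw lam) F strayMarks measurableSet_strayMarks hp0
    hF).trans ?_
  have hsum := Finset.sum_le_sum hrow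
  rw [Finset.sum_const, nsmul_eq_mul] at hsum
  refine (sub_le_sub_right (div_le_div_of_nonneg_right hsum (by positivity)) 1).trans (le_of_eq ?_)
  field_simp
  ring

/-- Whatever the clocks, an end at `x` has travelled a route to `x`, and the marks rule out every
such route. -/
theorem not_inc_of_mem_strayMarks {ω : Sample} {t : ℝ} {x : Vertex} (h : ω.2 ∈ strayMarks x)
    (e : Edge) : ¬ (graphAt ω t).Inc e x := by
  rintro ⟨y, b, ⟨hv, -⟩, -⟩
  obtain ⟨hk, l, hl, hf⟩ := hv.follow
  exact h e.1 e.2 hk ⟨b, l, hl, hf⟩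

theorem incomparable_of_alive {ω : Sample} {t : ℝ} (hpos : ∀ v, 0 < ω.1 v) {x y : Vertex}
    (hx : Alive ω t x) (hy : Alive ω t y) (hxy : x ≠ y) : Incomparable x y := by
  constructor
  · intro h
    have := splitTime_le_birthTime hpos h hxy
    linarith [hx.2, hy.1]
  · intro h
    have := splitTime_le_birthTime hpos h hxy.symm
    linarith [hy.2, hx.1]

/-- For fixed first coordinate, any single admissible `i` gives the bound. Imposing the condition
for all admissible `i` avoids a measurable selection; countability makes the event measurable. -/
theorem prod_forall_le_of_countable {α β ι : Type*} [MeasurableSpace α] [MeasurableSpace β]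
    [Countable ι] (μ : Measure α) [IsProbabilityMeasure μ] (ν : Measure β) [SFinite ν]
    {C : ι → Set α} {N : ι → Set β} (hC : ∀ i, MeasurableSet (C i)) (hN : ∀ i, MeasurableSet (N i))
    {b : ℝ≥0∞} (hb : ∀ i, ν (N i) ≤ b) :
    (μ.prod ν) {p | (∃ i, p.1 ∈ C i) ∧ ∀ i, p.1 ∈ C i → p.2 ∈ N i} ≤ b := by
  have hm : MeasurableSet {p : α × β | (∃ i, p.1 ∈ C i) ∧ ∀ i, p.1 ∈ C i → p.2 ∈ N i} := by
    have : {p : α × β | (∃ i, p.1 ∈ C i) ∧ ∀ i, p.1 ∈ C i → p.2 ∈ N i} =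
        (⋃ i, Prod.fst ⁻¹' C i) ∩ ⋂ i, ((Prod.fst ⁻¹' C i)ᶜ ∪ Prod.snd ⁻¹' N i) := by
      ext p
      simp only [Set.mem_ofPred_eq, Set.mem_inter_iff, Set.mem_iUnion, Set.mem_iInter, Set.mem_union,
        Set.mem_compl_iff, Set.mem_preimage, imp_iff_not_or]
    rw [this]
    exact (MeasurableSet.iUnion fun i => measurable_fst (hC i)).inter
      (MeasurableSet.iInter fun i => (measurable_fst (hC i)).compl.union (measurable_snd (hN i)))
  rw [Measure.prod_apply hm]
  calc _ ≤ ∫⁻ _, b ∂μ := by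
        refine lintegral_mono fun a => ?_
        by_cases h : ∃ i, a ∈ C i
        · obtain ⟨i, hi⟩ := h
          exact (measure_mono fun y hy => hy.2 i hi).trans (hb i)
        · have : Prod.mk a ⁻¹' {p : α × β | (∃ i, p.1 ∈ C i) ∧ ∀ i, p.1 ∈ C i → p.2 ∈ N i} = ∅ := by
            ext y
            simp only [Set.mem_preimage, Set.mem_ofPred_eq, Set.mem_empty_iff_false, iff_false]
            exact fun h' => h h'.1
          rw [this, measure_empty]
          exact zero_le
    _ = b := by simp

/-- The second-moment bound for the absence of isolated vertices. -/
theorem law_not_hasIsolatedVertex_le (lam : ℝ≥0) {t κ : ℝ} (ht : 0 ≤ t) (hκ : 0 < κ) (R : ℕ)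
    {M : ℕ} (hM : 0 < M) :
    law lam {ω | ¬ HasIsolatedVertex (graphAt ω t)} ≤
      ENNReal.ofReal ((1 + κ) ^ M * yuleGen κ t) +
      ENNReal.ofReal ((Real.exp (lam * (1 / 2) ^ R) - 1) +
        (4 ^ (R + 1) * Real.exp (lam / 2) + Real.exp lam) / M) := by
  set A : Set (Vertex → ℝ) := {c | ¬ ∀ v, 0 < c v} with hA
  set B : Set (Vertex → ℝ) :=
    {c | ¬ ∃ F : Finset Vertex, F.card = M ∧ ∀ v ∈ F, ClockAlive c t v} with hB
  let ι : Type := {F : Finset Vertex // F.card = M ∧ ∀ x ∈ F, ∀ y ∈ F, x ≠ y → Incomparable x y}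
  let C : ι → Set (Vertex → ℝ) := fun F => {c | ∀ v ∈ F.1, ClockAlive c t v}
  let N : ι → Set Marks := fun F => {η | ∀ x ∈ F.1, η ∉ strayMarks x}
  have hsub : {ω : Sample | ¬ HasIsolatedVertex (graphAt ω t)} ⊆
      (A ×ˢ Set.univ) ∪ ((B ×ˢ Set.univ) ∪
        {p | (∃ i, p.1 ∈ C i) ∧ ∀ i, p.1 ∈ C i → p.2 ∈ N i}) := by
    intro ω hω
    by_contra hn
    simp only [Set.mem_union, Set.mem_prod, Set.mem_univ, and_true, not_or] at hn
    obtain ⟨h1, h2, h3⟩ := hn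
    have hpos : ∀ v, 0 < ω.1 v := by
      by_contra h
      exact h1 h
    have h2' : ∃ F : Finset Vertex, F.card = M ∧ ∀ v ∈ F, ClockAlive ω.1 t v := by
      by_contra h
      exact h2 h
    obtain ⟨F, hF, hal⟩ := h2'
    refine h3 ⟨⟨⟨F, hF, fun x hx y hy hxy => incomparable_of_alive hpos
      ((alive_iff ω t x).2 (hal x hx)) ((alive_iff ω t y).2 (hal y hy)) hxy⟩, hal⟩, ?_⟩
    intro G hG x hx hstray
    exact hω ⟨x, (alive_iff ω t x).2 (hG x hx), not_inc_of_mem_strayMarks hstray⟩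
  refine (measure_mono hsub).trans ((measure_union_le _ _).trans ?_)
  have hA0 : law lam (A ×ˢ Set.univ) = 0 := by
    rw [law_eq, Measure.prod_prod, show clockLaw A = 0 from ae_iff.1 ae_clock_pos, zero_mul]
  rw [hA0, zero_add]
  refine (measure_union_le _ _).trans (add_le_add ?_ ?_)
  · rw [law_eq, Measure.prod_prod, measure_univ, mul_one]
    exact clockLaw_few_alive_le hκ ht M
  · refine prod_forall_le_of_countable clockLaw (markLaw lam) (fun F => ?_) (fun F => ?_) fun F => ?_
    · have : C F = ⋂ v ∈ F.1, {c | ClockAlive c t v} := by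
        ext c; simp [C]
      rw [this]
      exact Finset.measurableSet_biInter _ fun v _ => measurableSet_clockAlive t v
    · have : N F = ⋂ x ∈ F.1, (strayMarks x)ᶜ := by
        ext η; simp [N]
      rw [this]
      exact Finset.measurableSet_biInter _ fun x _ => (measurableSet_strayMarks x).compl
    · have h := markLaw_forall_notMem_strayMarks_le lam R
        (F := F.1) (Finset.card_pos.1 (by rw [F.2.1]; exact hM)) F.2.2
      rw [F.2.1] at h
      rw [← ofReal_measureReal (μ := markLaw lam)]
      exact ENNReal.ofReal_le_ofReal h

/-! ### Passage to the limit -/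

theorem not_hasIsolatedVertex_of_isConnected {ω : Sample} {t : ℝ}
    (hF : ∃ F : Finset Vertex, F.card = 2 ∧ ∀ v ∈ F, ClockAlive ω.1 t v)
    (h : IsConnected (graphAt ω t)) : ¬ HasIsolatedVertex (graphAt ω t) := by
  rintro ⟨x, hx, hiso⟩
  obtain ⟨F, hF, hal⟩ := hF
  obtain ⟨y, hy, hyx⟩ := Finset.exists_mem_ne (by omega : 1 < F.card) x
  have hxy := h.2 x hx y ((alive_iff ω t y).2 (hal y hy))
  rcases Relation.ReflTransGen.cases_head hxy with h' | ⟨z, ⟨e, hz⟩, -⟩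
  · exact hyx h'.symm
  · exact hiso e ⟨z, hz⟩

/-- The probability that there are less than two vertices. -/
theorem law_few_alive_le (lam : ℝ≥0) {t : ℝ} (ht : 0 ≤ t) :
    law lam {ω | ¬ ∃ F : Finset Vertex, F.card = 2 ∧ ∀ v ∈ F, ClockAlive ω.1 t v} ≤
      ENNReal.ofReal (4 * Real.exp (-t)) := by
  have hset : {ω : Sample | ¬ ∃ F : Finset Vertex, F.card = 2 ∧ ∀ v ∈ F, ClockAlive ω.1 t v} =
      {c | ¬ ∃ F : Finset Vertex, F.card = 2 ∧ ∀ v ∈ F, ClockAlive c t v} ×ˢ Set.univ := by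
    ext ω; simp
  rw [hset, law_eq, Measure.prod_prod, measure_univ, mul_one]
  -- With `κ = 1` the tail bound is 2^2 / (1 + e^t).
  refine (clockLaw_few_alive_le one_pos ht 2).trans (ENNReal.ofReal_le_ofReal ?_)
  rw [yuleGen, one_mul, Real.exp_neg, one_div]
  norm_num
  exact inv_anti₀ (Real.exp_pos t) (by linarith)

theorem probConnected_le_and_probIsolated_le (lam : ℝ≥0) {t : ℝ} (ht : 0 ≤ t) :
    probConnected lam t ≤ law lam {ω | ¬ HasIsolatedVertex (graphAt ω t)} +
        ENNReal.ofReal (4 * Real.exp (-t)) ∧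
    probIsolated lam t ≤ law lam {ω | ¬ IsConnected (graphAt ω t)} +
        ENNReal.ofReal (4 * Real.exp (-t)) := by
  constructor
  · refine le_trans ?_ (add_le_add_right (law_few_alive_le lam ht) _)
    refine (measure_mono fun ω hω => ?_).trans (measure_union_le _ _)
    by_contra hn
    simp only [Set.mem_union, Set.mem_ofPred_eq, not_or, not_not] at hn
    exact not_hasIsolatedVertex_of_isConnected hn.2 hω hn.1
  · refine le_trans ?_ (add_le_add_right (law_few_alive_le lam ht) _)
    refine (measure_mono fun ω hω => ?_).trans (measure_union_le _ _)
    by_contra hn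
    simp only [Set.mem_union, Set.mem_ofPred_eq, not_or, not_not] at hn
    exact not_hasIsolatedVertex_of_isConnected hn.2 hn.1 hω

theorem tendsto_exp_mul_add_atTop {a : ℝ} (ha : a < 0) (b : ℝ) :
    Tendsto (fun t : ℝ => Real.exp (a * t + b)) atTop (𝓝 0) :=
  Real.tendsto_exp_atBot.comp
    (tendsto_atBot_add_const_right _ _ (tendsto_id.const_mul_atTop_of_neg ha))

/-- Subadditivity alone is required, so the graph events need not be known to be measurable. -/
theorem tendsto_one_of_compl {f g : ℝ → ℝ≥0∞} (h1 : ∀ t, f t ≤ 1) (h2 : ∀ t, 1 ≤ f t + g t)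
    (hg : Tendsto g atTop (𝓝 0)) : Tendsto f atTop (𝓝 1) := by
  have h3 : Tendsto (fun t => 1 - g t) atTop (𝓝 (1 - 0)) :=
    ENNReal.Tendsto.sub tendsto_const_nhds hg (Or.inl ENNReal.one_ne_top)
  rw [tsub_zero] at h3
  exact tendsto_of_tendsto_of_tendsto_of_le_of_le h3 tendsto_const_nhds
    (fun t => tsub_le_iff_right.2 (h2 t)) h1

theorem one_le_law_add_compl (lam : ℝ≥0) (S : Set Sample) : 1 ≤ law lam S + law lam Sᶜ := by
  rw [← measure_univ (μ := law lam), ← Set.union_compl_self S]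
  exact measure_union_le _ _

theorem tendsto_law_not_isConnected {ε : ℝ} (hε : 0 < ε) {lam : ℝ → ℝ≥0}
    (h : ∀ᶠ t in atTop, (1 + ε) * t ≤ (lam t : ℝ)) :
    Tendsto (fun t => law (lam t) {ω | ¬ IsConnected (graphAt ω t)}) atTop (𝓝 0) := by
  -- Replacing λ by λ(1 - 2^(-(K+1))) then costs at most εt/4. With `δ = ε / 2` the exponent is at
  -- most (1 + ε/2)t - (1 + ε)t + εt/4 = -εt/4.
  obtain ⟨K, hK⟩ := exists_pow_lt_of_lt_one (show 0 < ε / (4 * (1 + ε)) by positivity)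
    (show (1 / 2 : ℝ) < 1 by norm_num)
  have hK' : (1 / 2 : ℝ) ^ (K + 1) ≤ ε / (4 * (1 + ε)) :=
    (pow_le_pow_of_le_one (by norm_num) (by norm_num) (Nat.le_succ K)).trans hK.le
  set D : ℝ := Fintype.card (Fin K → Failure K) * ((2 + ε / 2) / (ε / 2)) with hD
  have hlim : Tendsto (fun t : ℝ => ENNReal.ofReal (2 ^ K * Real.exp (-(1 / 2) * t + 0)) +
      ENNReal.ofReal (D * Real.exp (-(ε / 4) * t + 0))) atTop (𝓝 0) := by
    have h1 := (tendsto_exp_mul_add_atTop (show -(1 / 2 : ℝ) < 0 by norm_num) 0).const_mul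
      ((2 : ℝ) ^ K)
    have h2 := (tendsto_exp_mul_add_atTop (show -(ε / 4) < 0 by linarith) 0).const_mul D
    have := (ENNReal.tendsto_ofReal h1).add (ENNReal.tendsto_ofReal h2)
    simpa using this
  refine tendsto_of_tendsto_of_tendsto_of_le_of_le' tendsto_const_nhds hlim
    (Eventually.of_forall fun _ => zero_le) ?_
  filter_upwards [h, eventually_ge_atTop 0] with t hl ht
  refine (law_not_isConnected_le (lam t) ht K (half_pos hε)).trans (add_le_add ?_ ?_)
  · refine ENNReal.ofReal_le_ofReal ?_
    gcongr
    nlinarith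
  · refine ENNReal.ofReal_le_ofReal ?_
    gcongr
    have h1 : 1 - ε / (4 * (1 + ε)) ≤ 1 - (1 / 2 : ℝ) ^ (K + 1) := by linarith
    have h0 : 0 ≤ 1 - ε / (4 * (1 + ε)) := by
      rw [sub_nonneg, div_le_one (by positivity)]; linarith
    have h2 : (1 + ε) * t * (1 - ε / (4 * (1 + ε))) ≤ lam t * (1 - (1 / 2 : ℝ) ^ (K + 1)) :=
      mul_le_mul hl h1 h0 (lam t).2
    have h3 : (1 + ε) * t * (1 - ε / (4 * (1 + ε))) = (1 + ε) * t - ε / 4 * t := by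
      field_simp
    linarith

theorem tendsto_law_not_hasIsolatedVertex {ε : ℝ} (hε : 0 < ε) {lam : ℝ → ℝ≥0}
    (h : ∀ᶠ t in atTop, (lam t : ℝ) ≤ (1 - ε) * t) :
    Tendsto (fun t => law (lam t) {ω | ¬ HasIsolatedVertex (graphAt ω t)}) atTop (𝓝 0) := by
  -- Half of the gap 2δ ≤ ε makes `M` small against e^t, the other half makes it large against e^λ;
  -- the cap keeps 1 - δ positive.
  set δ : ℝ := min (ε / 2) (1 / 8) with hδ
  have hδ0 : 0 < δ := lt_min (by linarith) (by norm_num)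
  have hδ1 : δ ≤ 1 / 8 := min_le_right _ _
  have hδ2 : 2 * δ ≤ ε := by
    have := min_le_left (ε / 2) (1 / 8)
    linarith
  have hlim : Tendsto (fun t : ℝ => ENNReal.ofReal (2 * Real.exp (-δ * t + 1)) +
      ENNReal.ofReal ((Real.exp (t * Real.exp (-(1 / 16) * t)) - 1) +
        (Real.exp (-(1 / 8) * t + 4) + Real.exp (-δ * t + 0)))) atTop (𝓝 0) := by
    have h1 := (tendsto_exp_mul_add_atTop (show -δ < 0 by linarith) 1).const_mul 2
    have h2 : Tendsto (fun t : ℝ => t * Real.exp (-(1 / 16) * t)) atTop (𝓝 0) := by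
      have := Real.tendsto_pow_mul_exp_neg_atTop_nhds_zero 1
      have h16 : Tendsto (fun t : ℝ => t / 16) atTop atTop :=
        tendsto_id.atTop_div_const (by norm_num)
      have h' := (this.comp h16).const_mul 16
      rw [mul_zero] at h'
      refine h'.congr fun t => ?_
      simp only [Function.comp, pow_one]
      rw [show -(t / 16) = -(1 / 16) * t by ring]
      ring
    have h3 := ((Real.continuous_exp.tendsto 0).comp h2).sub_const 1
    have h4 := tendsto_exp_mul_add_atTop (show -(1 / 8 : ℝ) < 0 by norm_num) 4
    have h5 := tendsto_exp_mul_add_atTop (show -δ < 0 by linarith) 0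
    have := (ENNReal.tendsto_ofReal h1).add (ENNReal.tendsto_ofReal (h3.add (h4.add h5)))
    simpa using this
  refine tendsto_of_tendsto_of_tendsto_of_le_of_le' tendsto_const_nhds hlim
    (Eventually.of_forall fun _ => zero_le) ?_
  filter_upwards [h, eventually_ge_atTop 0] with t hl ht
  set M : ℕ := ⌈Real.exp ((1 - δ) * t)⌉₊ with hM
  -- Large enough for λ 2^(-R) → 0, and small enough that 4^(R+1) e^(λ/2), at most e^(t/4 + 4 +
  -- λ/2), is beaten by `M`.
  set R : ℕ := ⌊t / 8⌋₊ + 1 with hR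
  have hMle : Real.exp ((1 - δ) * t) ≤ M := Nat.le_ceil _
  have hM0 : (0 : ℝ) < M := (Real.exp_pos _).trans_le hMle
  have hM0' : 0 < M := by exact_mod_cast hM0
  have hM1 : (1 : ℝ) ≤ M := by exact_mod_cast hM0'
  have hMlt : (M : ℝ) ≤ 2 * Real.exp ((1 - δ) * t) := by
    have h1 := Nat.ceil_lt_add_one (Real.exp_pos ((1 - δ) * t)).le
    have h2 : 1 ≤ Real.exp ((1 - δ) * t) := Real.one_le_exp (mul_nonneg (by linarith) ht)
    linarith
  have hR1 : t / 8 ≤ R := by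
    rw [hR]; push_cast
    exact (Nat.lt_floor_add_one _).le
  have hR2 : (R : ℝ) ≤ t / 8 + 1 := by
    rw [hR]; push_cast
    linarith [Nat.floor_le (show 0 ≤ t / 8 by linarith)]
  have hlam : (lam t : ℝ) ≤ (1 - 2 * δ) * t := hl.trans (by nlinarith)
  -- With `κ = 1 / M` the factor (1 + κ)^M stays below e, while `yuleGen` is at most M e^(-t).
  refine (law_not_hasIsolatedVertex_le (lam t) ht (inv_pos.2 hM0) R hM0').trans
    (add_le_add (ENNReal.ofReal_le_ofReal ?_) (ENNReal.ofReal_le_ofReal ?_))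
  · have h1 : (1 + (M : ℝ)⁻¹) ^ M ≤ Real.exp 1 := by
      calc (1 + (M : ℝ)⁻¹) ^ M ≤ Real.exp (M : ℝ)⁻¹ ^ M := by
            gcongr
            linarith [Real.add_one_le_exp (M : ℝ)⁻¹]
        _ = Real.exp 1 := by rw [← Real.exp_nat_mul, mul_inv_cancel₀ hM0.ne']
    have h2 : yuleGen (M : ℝ)⁻¹ t ≤ 2 * Real.exp (-δ * t) := by
      have : yuleGen (M : ℝ)⁻¹ t ≤ M * Real.exp (-t) := by
        rw [yuleGen, div_le_iff₀ (by positivity)]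
        have : (M : ℝ) * Real.exp (-t) * (1 + (M : ℝ)⁻¹ * Real.exp t) =
            M * Real.exp (-t) + 1 := by
          rw [Real.exp_neg]; field_simp
        rw [this]
        have := mul_pos hM0 (Real.exp_pos (-t))
        linarith
      calc _ ≤ M * Real.exp (-t) := this
        _ ≤ 2 * Real.exp ((1 - δ) * t) * Real.exp (-t) := by gcongr
        _ = 2 * Real.exp (-δ * t) := by
          rw [mul_assoc, ← Real.exp_add]; ring_nf
    calc _ ≤ Real.exp 1 * (2 * Real.exp (-δ * t)) :=
          mul_le_mul h1 h2 (yuleGen_pos (inv_pos.2 hM0) t).le (Real.exp_pos _).le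
      _ = _ := by rw [Real.exp_add]; ring
  · have hhalf : (1 / 2 : ℝ) ^ R ≤ Real.exp (-(1 / 16) * t) := by
      calc (1 / 2 : ℝ) ^ R ≤ Real.exp (-(1 / 2)) ^ R := by
            gcongr
            linarith [Real.add_one_le_exp (-(1 / 2 : ℝ))]
        _ = Real.exp (R * -(1 / 2)) := by rw [← Real.exp_nat_mul]
        _ ≤ _ := Real.exp_le_exp.2 (by linarith)
    have hfour : (4 : ℝ) ^ (R + 1) ≤ Real.exp (t / 4 + 4) := by
      have he : (4 : ℝ) ≤ Real.exp 2 := by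
        have h1 := Real.add_one_le_exp (1 : ℝ)
        have h2 : Real.exp 2 = Real.exp 1 * Real.exp 1 := by rw [← Real.exp_add]; norm_num
        nlinarith
      calc (4 : ℝ) ^ (R + 1) ≤ Real.exp 2 ^ (R + 1) := by gcongr
        _ = Real.exp ((R + 1 : ℕ) * 2) := by rw [← Real.exp_nat_mul]
        _ ≤ _ := Real.exp_le_exp.2 (by push_cast; linarith)
    have hdt : 0 ≤ δ * t := by positivity
    have hlt : (lam t : ℝ) ≤ t := by nlinarith
    have hinv : (M : ℝ)⁻¹ ≤ Real.exp (-((1 - δ) * t)) := by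
      rw [Real.exp_neg]
      exact inv_anti₀ (Real.exp_pos _) hMle
    gcongr ?_ + ?_
    · gcongr
    · rw [div_eq_mul_inv, add_mul]
      refine add_le_add ?_ ?_
      · calc _ ≤ Real.exp (t / 4 + 4) * Real.exp (lam t / 2) * Real.exp (-((1 - δ) * t)) := by gcongr
          _ = Real.exp (t / 4 + 4 + lam t / 2 - (1 - δ) * t) := by
            rw [← Real.exp_add, ← Real.exp_add]; rfl
          _ ≤ _ := Real.exp_le_exp.2 (by nlinarith)
      · calc _ ≤ Real.exp (lam t) * Real.exp (-((1 - δ) * t)) := by gcongr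
          _ = Real.exp (lam t - (1 - δ) * t) := by rw [← Real.exp_add]; rfl
          _ ≤ _ := Real.exp_le_exp.2 (by nlinarith)

end AsyncSplitting

theorem mainTheorem8 (ε : ℝ) (hε : 0 < ε) (lam : ℝ → ℝ≥0) :
    ((∀ᶠ t in atTop, (lam t : ℝ) ≤ (1 - ε) * t) →
      Tendsto (fun t => AsyncSplitting.probIsolated (lam t) t) atTop (𝓝 1) ∧
      Tendsto (fun t => AsyncSplitting.probConnected (lam t) t) atTop (𝓝 0)) ∧
    ((∀ᶠ t in atTop, (1 + ε) * t ≤ (lam t : ℝ)) →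
      Tendsto (fun t => AsyncSplitting.probIsolated (lam t) t) atTop (𝓝 0) ∧
      Tendsto (fun t => AsyncSplitting.probConnected (lam t) t) atTop (𝓝 1)) := by
  have hfew : Tendsto (fun t : ℝ => ENNReal.ofReal (4 * Real.exp (-t))) atTop (𝓝 0) := by
    have := ENNReal.tendsto_ofReal (Real.tendsto_exp_neg_atTop_nhds_zero.const_mul 4)
    simpa using this
  constructor
  · intro h
    have hiso := AsyncSplitting.tendsto_law_not_hasIsolatedVertex hε h
    refine ⟨AsyncSplitting.tendsto_one_of_compl (fun t => prob_le_one)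
      (fun t => AsyncSplitting.one_le_law_add_compl _ _) hiso, ?_⟩
    have hsum := hiso.add hfew
    rw [add_zero] at hsum
    refine tendsto_of_tendsto_of_tendsto_of_le_of_le' tendsto_const_nhds hsum
      (Eventually.of_forall fun _ => zero_le) ?_
    filter_upwards [eventually_ge_atTop 0] with t ht
    exact (AsyncSplitting.probConnected_le_and_probIsolated_le (lam t) ht).1
  · intro h
    have hconn := AsyncSplitting.tendsto_law_not_isConnected hε h
    refine ⟨?_, AsyncSplitting.tendsto_one_of_compl (fun t => prob_le_one)
      (fun t => AsyncSplitting.one_le_law_add_compl _ _) hconn⟩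
    have hsum := hconn.add hfew
    rw [add_zero] at hsum
    refine tendsto_of_tendsto_of_tendsto_of_le_of_le' tendsto_const_nhds hsum
      (Eventually.of_forall fun _ => zero_le) ?_
    filter_upwards [eventually_ge_atTop 0] with t ht
    exact (AsyncSplitting.probConnected_le_and_probIsolated_le (lam t) ht).2
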